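/- Let $m\ge 1$ and let $P,Q$ be $m\times m$ matrices of real rational functions of $z$, both proper, with $Q$ symmetric. Write $M^*$ for the conjugate transpose. Assume: (a) $P$ is discrete negative imaginary (D-NI): $P$ is analytic in $\{|z|>1\}$, and on this set $i[P(z)-P(z)^*]$ is positive semidefinite when $\operatorname{Im} z>0$, zero when $\operatorname{Im} z=0$, and negative semidefinite when $\operatorname{Im} z<0$; moreover $P$ has no poles at $+1$ and $-1$. (b) $Q$ is discrete weakly strictly negative imaginary (D-WSNI): all poles of $Q$ lie in $\{|z|<1\}$, and $i[Q(e^{i\theta})-Q(e^{i\theta})^*]$ is positive definite for all $\theta\in(0,\pi)$. (c) $P(-1)Q(-1)=0$ and $Q(-1)$ is positive semidefinite. Then all eigenvalues of $P(1)Q(1)$ are real, and, with $\bar\lambda$ denoting the largest eigenvalue, $$[P,Q]\ \text{is internally stable}\iff \bar\lambda\big(P(1)Q(1)\big)<1.$$ Here $[P,Q]$ is the positive feedback interconnection with two exogenous input signals $w_1,w_2:\{0,1,2,\dots\}\to\mathbb R^m$, $$e_1=w_1+Qe_2,\qquad e_2=w_2+Pe_1,$$ where a proper transfer function $G(z)=\sum_{k\ge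 0}G_kz^{-k}$ acts on signals by $(Gu)(k)=\sum_{l=0}^{k}G_{k-l}\,u(l)$. It is internally stable if it is well posed (all $w_1,w_2$ determine $e_1,e_2$ uniquely) and, for all $w_1,w_2$ of finite energy ($\sum_k|w(k)|^2<\infty$), the internal signals $e_1,e_2$ and the outputs $Pe_1,Qe_2$ have finite energy. -/

import Mathlib

open scoped Polynomial ComplexOrder

noncomputable section

/-- A square `m × m` real rational transfer function `G(z)`: a matrix of rational functions in the
indeterminate `z` with real coefficients. -/
abbrev TransferMatrix (m : ℕ) : Type := Matrix (Fin m) (Fin m) (RatFunc ℝ)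

namespace TransferMatrix

variable {m : ℕ}

/-- The value `G(z) ∈ ℂ^{m × m}` at a point `z` which is not a pole. -/
def valueAt (G : TransferMatrix m) (z : ℂ) : Matrix (Fin m) (Fin m) ℂ :=
  G.map (RatFunc.eval (algebraMap ℝ ℂ) z)

/-- `z` is a (finite) pole of `G`: the reduced denominator of some entry vanishes at `z`. -/
def IsPole (G : TransferMatrix m) (z : ℂ) : Prop :=
  ∃ i j, Polynomial.aeval z (G i j).denom = 0

/-- `G` is proper: no entry has a pole at infinity. -/
def IsProper (G : TransferMatrix m) : Prop :=
  ∀ i j, (G i j).num.degree ≤ (G i j).denom.degree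

/-- The Hermitian matrix `i [G(z) - G(z)^*]`. -/
def skewPart (G : TransferMatrix m) (z : ℂ) : Matrix (Fin m) (Fin m) ℂ :=
  Complex.I • (G.valueAt z - (G.valueAt z).conjTranspose)

/-- Discrete negative imaginary (D-NI), for real rational transfer functions. For a rational
function, being analytic in `|z| > 1` means having no poles there. -/
structure IsDNI (G : TransferMatrix m) : Prop where
  analytic : ∀ z : ℂ, 1 < ‖z‖ → ¬ G.IsPole z
  upper : ∀ z : ℂ, 1 < ‖z‖ → 0 < z.im → (G.skewPart z).PosSemidef
  real : ∀ z : ℂ, 1 < ‖z‖ → z.im = 0 → G.skewPart z = 0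
  lower : ∀ z : ℂ, 1 < ‖z‖ → z.im < 0 → (-G.skewPart z).PosSemidef

/-- Discrete weakly strictly negative imaginary (D-WSNI), for real rational transfer functions. -/
structure IsDWSNI (G : TransferMatrix m) : Prop where
  poles : ∀ z : ℂ, G.IsPole z → ‖z‖ < 1
  circle : ∀ θ : ℝ, θ ∈ Set.Ioo 0 Real.pi →
    (G.skewPart (Complex.exp ((θ : ℂ) * Complex.I))).PosDef

/-- A discrete-time signal on `k = 0, 1, 2, …` with values in `ℝ^m`. -/
abbrev Signal (m : ℕ) : Type := ℕ → Fin m → ℝ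

/-- Finite energy: `∑ₖ |u(k)|² < ∞`. -/
def FiniteEnergy (u : Signal m) : Prop :=
  Summable fun k => ∑ i, u k i ^ 2

/-- The impulse response `h(0), h(1), …` of a proper rational function `f`, i.e. the coefficients
of its expansion `f(z) = ∑ₖ h(k) z⁻ᵏ` at infinity. With `n = deg (denom f)` and `x = 1 / z`, one
has `f = (xⁿ num(1/x)) / (xⁿ denom(1/x))`; the constant term of `xⁿ denom(1/x)` is nonzero. -/
def impulseResponse (f : RatFunc ℝ) (k : ℕ) : ℝ :=
  PowerSeries.coeff k
    (((f.num.reflect f.denom.natDegree : ℝ[X]) : PowerSeries ℝ) *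
      ((f.denom.reverse : ℝ[X]) : PowerSeries ℝ)⁻¹)

/-- The output of the causal system (at rest before time `0`) with proper transfer function `G` for
the input `u`: convolution with the impulse response of `G`. -/
def output (G : TransferMatrix m) (u : Signal m) : Signal m :=
  fun k i => ∑ j, ∑ l ∈ Finset.range (k + 1), impulseResponse (G i j) (k - l) * u l j

/-- The equations of the positive feedback interconnection `[P, Q]` with exogenous signals
`w₁, w₂` added at the inputs of `P` and `Q`: the input `e₁` of `P` is `w₁` plus the output of `Q`,
and the input `e₂` of `Q` is `w₂` plus the output of `P`. -/
def IsLoopSolution (P Q : TransferMatrix m) (w₁ w₂ e₁ e₂ : Signal m) : Prop :=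
  e₁ = w₁ + Q.output e₂ ∧ e₂ = w₂ + P.output e₁

/-- Internal stability of the positive feedback interconnection `[P, Q]`: it is well posed (all
exogenous signals determine the internal signals uniquely), and for all exogenous signals of finite
energy, all internal and output signals have finite energy. -/
def InternallyStable (P Q : TransferMatrix m) : Prop :=
  (∀ w₁ w₂ : Signal m, ∃! e : Signal m × Signal m, IsLoopSolution P Q w₁ w₂ e.1 e.2) ∧
  ∀ w₁ w₂ e₁ e₂ : Signal m, FiniteEnergy w₁ → FiniteEnergy w₂ →
    IsLoopSolution P Q w₁ w₂ e₁ e₂ →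
      FiniteEnergy e₁ ∧ FiniteEnergy e₂ ∧ FiniteEnergy (P.output e₁) ∧ FiniteEnergy (Q.output e₂)

end TransferMatrix

/-- All (complex) eigenvalues of the square matrix `A` are real. -/
def HasOnlyRealEigenvalues {m : ℕ} (A : Matrix (Fin m) (Fin m) ℂ) : Prop :=
  ∀ μ ∈ spectrum ℂ A, μ.im = 0

/-- The largest eigenvalue of a nonempty square matrix that has only real eigenvalues. -/
def largestEigenvalue {m : ℕ} (A : Matrix (Fin m) (Fin m) ℂ) : ℝ :=
  sSup {x : ℝ | (x : ℂ) ∈ spectrum ℂ A}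

end

/-!
In the variable `x = 1 / z` the hypotheses live on the unit disc: `P` is holomorphic inside it, `Q`
up to the boundary. For every vector `v` the function `v* P(x) v` sends the lower half-disc to the
closed lower half-plane and `v* Q(x) v`, by the maximum principle for harmonic functions, sends it
to the open one. Both are real on `[-1, 1]`, so there they are increasing. Hence `P` is monotone
and `Q` strictly so, `Q` is positive definite on `(-1, 1]`, and `Q⁻¹ - P` is antitone. It is
positive definite near `-1`, where `P Q` is small, and along `[-1, 1]` it can lose positivity only
where `1 - P Q` is singular. So `1 - P Q` is invertible on all of `[-1, 1]` if and only if
`Q(1)⁻¹ - P(1)` is positive definite, that is, every eigenvalue of `P(1) Q(1)` is less than `1`.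

Internal stability says that the closed-loop transfer matrix has no pole in the closed disc.
At a point of `[-1, 1]` a singular `1 - P Q` always produces a pole. At a point of the lower
half-plane the imaginary parts of `⟨e₁, P e₁⟩ ≤ 0` and `⟨e₂, Q e₂⟩ ≤ -c |e₂|²` in the loop equations
bound `e₂` by the inputs, uniformly as the point is approached from inside the disc; this excludes
a pole even at the points of the unit circle where `P` itself has one. The upper half-plane
follows by conjugation.
-/

open Set Filter Topology

section StrictPositivity

open scoped Ring

lemma isUnit_inverse_sub_iff {R : Type*} [Ring R] {p q : R} (hq : IsUnit q) :
    IsUnit (q⁻¹ʳ - p) ↔ IsUnit (1 - p * q) := by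
  rw [← hq.mul_right_iff, sub_mul, Ring.inverse_mul_cancel _ hq]

variable {A : Type*} [CStarAlgebra A] [PartialOrder A] [StarOrderedRing A] {p q : A}

lemma exists_pos_eventually_algebraMap_le {a : A} (ha : IsStrictlyPositive a) :
    ∃ c > 0, ∀ᶠ b in 𝓝 a, IsSelfAdjoint b → algebraMap ℝ A c ≤ b := by
  rcases subsingleton_or_nontrivial A with _ | _
  · exact ⟨1, one_pos, .of_forall fun b _ => (Subsingleton.elim _ b).le⟩
  obtain ⟨r, hr, hra⟩ :=
    (CFC.exists_pos_algebraMap_le_iff ha.isSelfAdjoint).2 fun _ hx => ha.spectrum_pos hx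
  refine ⟨r / 2, half_pos hr, ?_⟩
  filter_upwards [Metric.ball_mem_nhds a (half_pos hr)] with b hb hbsa
  have hdist : ‖b - a‖ ≤ r / 2 := (mem_ball_iff_norm.1 hb).le
  calc algebraMap ℝ A (r / 2) = algebraMap ℝ A r - algebraMap ℝ A (r / 2) := by
        rw [← map_sub, sub_half]
    _ ≤ a - algebraMap ℝ A ‖b - a‖ := sub_le_sub hra (algebraMap_mono A hdist)
    _ ≤ a + (b - a) := by
        rw [sub_eq_add_neg]
        exact add_le_add_right (hbsa.sub ha.isSelfAdjoint).neg_algebraMap_norm_le_self a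
    _ = b := add_sub_cancel a b

lemma eventually_isStrictlyPositive {a : A} (ha : IsStrictlyPositive a) :
    ∀ᶠ b in 𝓝 a, IsSelfAdjoint b → IsStrictlyPositive b := by
  obtain ⟨c, hc, h⟩ := exists_pos_eventually_algebraMap_le ha
  have hpos : IsStrictlyPositive (algebraMap ℝ A c) :=
    ⟨algebraMap_nonneg A hc.le, (IsUnit.mk0 c hc.ne').map _⟩
  filter_upwards [h] with b hb hbsa using hpos.of_le (hb hbsa)

lemma isStrictlyPositive_of_isPreconnected {X : Type*} [TopologicalSpace X] {s : Set X}
    (hs : IsPreconnected s) {f : X → A} (hf : ContinuousOn f s)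
    (hsa : ∀ x ∈ s, IsSelfAdjoint (f x)) (hunit : ∀ x ∈ s, IsUnit (f x)) {x₀ : X} (hx₀ : x₀ ∈ s)
    (h₀ : IsStrictlyPositive (f x₀)) {x : X} (hx : x ∈ s) : IsStrictlyPositive (f x) := by
  have : PreconnectedSpace s := Subtype.preconnectedSpace hs
  have hfs : Continuous (s.domRestrict f) := hf.domRestrict
  have hclosed : IsClosed {y : s | IsStrictlyPositive (f y)} := by
    have : {y : s | IsStrictlyPositive (f y)} = {y | 0 ≤ s.domRestrict f y} :=
      Set.ext fun y => ⟨fun h => h.nonneg, fun h => ⟨h, hunit y y.2⟩⟩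
    exact this ▸ isClosed_le continuous_const hfs
  have hopen : IsOpen {y : s | IsStrictlyPositive (f y)} := isOpen_iff_mem_nhds.2 fun y hy =>
    (hfs.continuousAt.eventually (eventually_isStrictlyPositive hy)).mono
      fun z hz => hz (hsa z z.2)
  exact (IsClopen.eq_univ ⟨hclosed, hopen⟩ ⟨⟨x₀, hx₀⟩, h₀⟩ ▸ mem_univ (⟨x, hx⟩ : s) :)

lemma spectrum_mul_diff_zero {𝕜 : Type*} [Field 𝕜] [Algebra 𝕜 A] (p : A) (hq : 0 ≤ q) :
    spectrum 𝕜 (p * q) \ {0} = spectrum 𝕜 (CFC.conjSqrt q p) \ {0} := by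
  conv_lhs => rw [← CFC.sqrt_mul_sqrt_self q, ← mul_assoc, spectrum.nonzero_mul_comm, ← mul_assoc]
  rfl

lemma isSelfAdjoint_conjSqrt (hp : IsSelfAdjoint p) (q : A) : IsSelfAdjoint (CFC.conjSqrt q p) :=
  hp.conjugate_self (CFC.sqrt_nonneg q).isSelfAdjoint

lemma im_eq_zero_of_mem_spectrum_mul (hp : IsSelfAdjoint p) (hq : 0 ≤ q) {μ : ℂ}
    (hμ : μ ∈ spectrum ℂ (p * q)) : μ.im = 0 := by
  rcases eq_or_ne μ 0 with rfl | hμ0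
  · rfl
  have hmem : μ ∈ spectrum ℂ (p * q) \ {0} := ⟨hμ, hμ0⟩
  rw [spectrum_mul_diff_zero p hq] at hmem
  exact (isSelfAdjoint_conjSqrt hp q).im_eq_zero_of_mem_spectrum hmem.1

lemma isStrictlyPositive_one_sub_iff {a : A} (ha : IsSelfAdjoint a) :
    IsStrictlyPositive (1 - a) ↔ ∀ μ ∈ spectrum ℝ a, μ < 1 := by
  rw [StarOrderedRing.isStrictlyPositive_iff_spectrum_pos (R := ℝ) _ (.sub (.one A) ha),
    ← map_one (algebraMap ℝ A), ← spectrum.singleton_sub_eq]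
  simp only [singleton_sub, forall_mem_image, sub_pos]

lemma isStrictlyPositive_inverse_sub_iff (hp : IsSelfAdjoint p) (hq : IsStrictlyPositive q) :
    IsStrictlyPositive (q⁻¹ʳ - p) ↔ ∀ μ ∈ spectrum ℝ (p * q), μ < 1 := by
  have hconj : CFC.conjSqrt q (q⁻¹ʳ - p) = 1 - CFC.conjSqrt q p := by
    have := CFC.conjSqrt_conjSqrt_ringInverse q 1
    rw [CFC.conjSqrt_one _ hq.ringInverse.nonneg] at this
    rw [map_sub, this]
  rw [← CFC.isStrictlyPositive_conjSqrt_iff q, hconj,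
    isStrictlyPositive_one_sub_iff (isSelfAdjoint_conjSqrt hp q)]
  refine forall_congr' fun μ => ?_
  rcases eq_or_ne μ 0 with rfl | hμ
  · simp
  · have hspec := Set.ext_iff.1 (spectrum_mul_diff_zero (𝕜 := ℝ) p hq.nonneg) μ
    simp only [Set.mem_sdiff, mem_singleton_iff, hμ, not_false_eq_true, and_true] at hspec
    rw [hspec]

lemma isUnit_one_sub_mul_of_le {p₁ q₁ : A} (hp₁ : IsSelfAdjoint p₁) (hpp₁ : p ≤ p₁)
    (hq : IsStrictlyPositive q) (hqq₁ : q ≤ q₁) (h : ∀ μ ∈ spectrum ℝ (p₁ * q₁), μ < 1) :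
    IsUnit (1 - p * q) := by
  have hpos := (isStrictlyPositive_inverse_sub_iff hp₁ (hq.of_le hqq₁)).2 h
  exact (isUnit_inverse_sub_iff hq.isUnit).1 (hpos.of_le
    (sub_le_sub (CStarAlgebra.ringInverse_le_ringInverse hqq₁ hq) hpp₁)).isUnit

variable {P Q : ℝ → A} {a b : ℝ}

lemma exists_isStrictlyPositive_inverse_sub (hab : a < b) (hP : ContinuousOn P (Icc a b))
    (hQ : ContinuousOn Q (Icc a b)) (hPsa : ∀ x ∈ Icc a b, IsSelfAdjoint (P x))
    (hQpos : ∀ x ∈ Ioc a b, IsStrictlyPositive (Q x)) (h₀ : P a * Q a = 0) :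
    ∃ x ∈ Ioc a b, IsStrictlyPositive ((Q x)⁻¹ʳ - P x) := by
  have hlim : Tendsto (fun x => ‖P x * Q x‖) (𝓝[Ioc a b] a) (𝓝 0) := by
    have := ((hP.mul hQ).norm a (left_mem_Icc.2 hab.le)).mono_left
      (nhdsWithin_mono a Ioc_subset_Icc_self)
    simpa [h₀] using this
  have : (𝓝[Ioc a b] a).NeBot := by
    rw [nhdsWithin_Ioc_eq_nhdsGT hab]
    infer_instance
  obtain ⟨x, hsmall, hx⟩ := ((hlim.eventually_lt_const one_pos).and self_mem_nhdsWithin).exists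
  refine ⟨x, hx, (isStrictlyPositive_inverse_sub_iff (hPsa x (Ioc_subset_Icc_self hx))
    (hQpos x hx)).2 fun μ hμ => ?_⟩
  have : Nontrivial A := not_subsingleton_iff_nontrivial.1 fun _ => by
    simp [spectrum.of_subsingleton] at hμ
  exact (Real.le_norm_self μ).trans_lt ((spectrum.norm_le_norm_of_mem hμ).trans_lt hsmall)

theorem isUnit_one_sub_mul_iff_spectrum_lt_one (hab : a < b) (hP : ContinuousOn P (Icc a b))
    (hQ : ContinuousOn Q (Icc a b)) (hPsa : ∀ x ∈ Icc a b, IsSelfAdjoint (P x))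
    (hPmono : MonotoneOn P (Icc a b)) (hQmono : MonotoneOn Q (Icc a b))
    (hQpos : ∀ x ∈ Ioc a b, IsStrictlyPositive (Q x)) (h₀ : P a * Q a = 0) :
    (∀ x ∈ Icc a b, IsUnit (1 - P x * Q x)) ↔ ∀ μ ∈ spectrum ℝ (P b * Q b), μ < 1 := by
  have hb : b ∈ Ioc a b := right_mem_Ioc.2 hab
  have hb' : b ∈ Icc a b := right_mem_Icc.2 hab.le
  constructor
  · intro hunit
    obtain ⟨x₀, hx₀, hpos⟩ := exists_isStrictlyPositive_inverse_sub hab hP hQ hPsa hQpos h₀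
    have hcont : ContinuousOn (fun x => (Q x)⁻¹ʳ - P x) (Ioc a b) := fun x hx => by
      have hxI := Ioc_subset_Icc_self hx
      obtain ⟨u, hu⟩ := (hQpos x hx).isUnit
      exact ((hu ▸ NormedRing.inverse_continuousAt u : ContinuousAt _ _).comp_continuousWithinAt
        ((hQ x hxI).mono Ioc_subset_Icc_self)).sub ((hP x hxI).mono Ioc_subset_Icc_self)
    rw [← isStrictlyPositive_inverse_sub_iff (hPsa b hb') (hQpos b hb)]
    exact isStrictlyPositive_of_isPreconnected isPreconnected_Ioc hcont
      (fun x hx => (hQpos x hx).isSelfAdjoint.ringInverse.sub (hPsa x (Ioc_subset_Icc_self hx)))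
      (fun x hx => (isUnit_inverse_sub_iff (hQpos x hx).isUnit).2
        (hunit x (Ioc_subset_Icc_self hx))) hx₀ hpos hb
  · intro h x hx
    rcases hx.1.eq_or_lt with rfl | hax
    · simp [h₀]
    · exact isUnit_one_sub_mul_of_le (hPsa b hb') (hPmono hx hb' hx.2) (hQpos x ⟨hax, hx.2⟩)
        (hQmono hx hb' hx.2) h

end StrictPositivity

section ImaginaryPart

/- Reduces bounds on imaginary parts to the maximum modulus principle. -/
lemma norm_exp_neg_I_mul (w : ℂ) : ‖Complex.exp (-Complex.I * w)‖ = Real.exp w.im := by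
  simp [Complex.norm_exp]

section MaximumPrinciple

variable {E : Type*} [NormedAddCommGroup E] [NormedSpace ℂ E] {U : Set E} {h : E → ℂ} {C : ℝ}

lemma diffContOnCl_exp_neg_I_mul (hd : DiffContOnCl ℂ h U) :
    DiffContOnCl ℂ (fun z => Complex.exp (-Complex.I * h z)) U :=
  Complex.differentiable_exp.comp_diffContOnCl (hd.const_smul (-Complex.I))

lemma im_le_of_forall_mem_frontier_im_le [Nontrivial E] (hU : Bornology.IsBounded U)
    (hd : DiffContOnCl ℂ h U) (hC : ∀ z ∈ frontier U, (h z).im ≤ C) {z : E}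
    (hz : z ∈ closure U) : (h z).im ≤ C := by
  have := Complex.norm_le_of_forall_mem_frontier_norm_le (C := Real.exp C) hU
    (diffContOnCl_exp_neg_I_mul hd)
    (fun w hw => by simpa only [norm_exp_neg_I_mul, Real.exp_le_exp] using hC w hw) hz
  simpa only [norm_exp_neg_I_mul, Real.exp_le_exp] using this

lemma im_lt_of_forall_mem_frontier_im_le [Nontrivial E] (hU : Bornology.IsBounded U)
    (hopen : IsOpen U) (hconn : IsPreconnected U) (hd : DiffContOnCl ℂ h U)
    (hC : ∀ z ∈ frontier U, (h z).im ≤ C) {w : E} (hw : w ∈ closure U) (hwC : (h w).im < C)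
    {z : E} (hz : z ∈ U) : (h z).im < C := by
  have hle : ∀ y ∈ closure U, (h y).im ≤ C := fun y =>
    im_le_of_forall_mem_frontier_im_le hU hd hC
  refine (hle z (subset_closure hz)).lt_of_ne fun heq => hwC.ne ?_
  have hmax : IsMaxOn (norm ∘ fun y => Complex.exp (-Complex.I * h y)) U z := fun y hy => by
    simpa only [mem_ofPred_eq, Function.comp_apply, norm_exp_neg_I_mul, Real.exp_le_exp, heq]
      using hle y (subset_closure hy)
  have := Complex.norm_eqOn_closure_of_isPreconnected_of_isMaxOn hconn hopen
    (diffContOnCl_exp_neg_I_mul hd) hz hmax hw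
  simpa only [Function.comp_apply, Function.const_apply, norm_exp_neg_I_mul, Real.exp_eq_exp,
    heq] using this

end MaximumPrinciple

/-- The open lower half disc. Under `x = 1 / z` it corresponds to the points `|z| > 1` of the
upper half plane. -/
def lowerHalfDisc : Set ℂ := Metric.ball 0 1 ∩ {x | x.im < 0}

lemma isOpen_lowerHalfDisc : IsOpen lowerHalfDisc :=
  Metric.isOpen_ball.inter (isOpen_lt Complex.continuous_im continuous_const)

lemma convex_lowerHalfDisc : Convex ℝ lowerHalfDisc :=
  (convex_ball 0 1).inter (convex_halfSpace_im_lt 0)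

lemma closure_lowerHalfDisc_subset :
    closure lowerHalfDisc ⊆ Metric.closedBall 0 1 ∩ {x | x.im ≤ 0} :=
  closure_minimal (inter_subset_inter Metric.ball_subset_closedBall fun x (hx : x.im < 0) => hx.le)
    (Metric.isClosed_closedBall.inter (isClosed_le Complex.continuous_im continuous_const))

lemma mem_closure_lowerHalfDisc {x : ℂ} (hx : ‖x‖ ≤ 1) (him : x.im < 0) :
    x ∈ closure lowerHalfDisc := by
  have hopen : IsOpen {y : ℂ | y.im < 0} := isOpen_lt Complex.continuous_im continuous_const
  rw [lowerHalfDisc, inter_comm]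
  refine hopen.inter_closure ⟨him, ?_⟩
  rwa [closure_ball 0 one_ne_zero, mem_closedBall_zero_iff]

lemma im_neg_of_norm_le_one {h : ℂ → ℂ} (hd : DiffContOnCl ℂ h lowerHalfDisc)
    (hreal : ∀ x : ℂ, ‖x‖ ≤ 1 → x.im = 0 → (h x).im ≤ 0)
    (hcirc : ∀ x : ℂ, ‖x‖ = 1 → x.im < 0 → (h x).im < 0) {x : ℂ} (hx : ‖x‖ ≤ 1)
    (him : x.im < 0) : (h x).im < 0 := by
  rcases hx.eq_or_lt with hx1 | hx1
  · exact hcirc x hx1 him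
  have hfrontier : ∀ y ∈ frontier lowerHalfDisc, (h y).im ≤ 0 := by
    rw [isOpen_lowerHalfDisc.frontier_eq]
    rintro y ⟨hycl, hy⟩
    obtain ⟨hy1, hyim⟩ := closure_lowerHalfDisc_subset hycl
    rw [mem_closedBall_zero_iff] at hy1
    rcases (show y.im ≤ 0 from hyim).eq_or_lt with h0 | h0
    · exact hreal y hy1 h0
    · exact (hcirc y (hy1.eq_of_not_lt fun hlt => hy ⟨mem_ball_zero_iff.2 hlt, h0⟩) h0).le
  exact im_lt_of_forall_mem_frontier_im_le (Metric.isBounded_ball.subset inter_subset_left)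
    isOpen_lowerHalfDisc convex_lowerHalfDisc.isPreconnected hd hfrontier
    (mem_closure_lowerHalfDisc (x := -Complex.I) (by simp) (by simp)) (hcirc _ (by simp) (by simp))
    ⟨mem_ball_zero_iff.2 hx1, him⟩

lemma re_deriv_nonneg_of_im_nonpos {h : ℂ → ℂ} {x : ℝ} (hd : DifferentiableAt ℂ h x)
    (hreal : (h x).im = 0) (hlow : ∀ᶠ z in 𝓝[{z | z.im < 0}] (x : ℂ), (h z).im ≤ 0) :
    0 ≤ (deriv h x).re := by
  have hline : HasDerivAt (fun t : ℝ => (x : ℂ) - t * Complex.I) (-Complex.I) 0 := by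
    simpa using ((Complex.ofRealCLM.hasDerivAt (x := 0)).mul_const Complex.I).const_sub (x : ℂ)
  have hderiv : HasDerivAt (fun t : ℝ => -(h (x - t * Complex.I)).im) (deriv h x).re 0 := by
    have hcomp : HasDerivAt (fun t : ℝ => h (x - t * Complex.I)) (deriv h x * -Complex.I) 0 :=
      HasDerivAt.comp (h₂ := h) (0 : ℝ) (by simpa using hd.hasDerivAt) hline
    simpa [Function.comp_def] using (Complex.imCLM.hasFDerivAt.comp_hasDerivAt 0 hcomp).fun_neg
  have hpath : Tendsto (fun t : ℝ => (x : ℂ) - t * Complex.I) (𝓝[>] 0)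
      (𝓝[{z | z.im < 0}] (x : ℂ)) := by
    refine tendsto_nhdsWithin_iff.2 ⟨?_, ?_⟩
    · simpa using hline.continuousAt.tendsto.mono_left (nhdsWithin_le_nhds (s := Ioi 0))
    · filter_upwards [self_mem_nhdsWithin] with t ht using by simpa using ht
  refine ge_of_tendsto hderiv.tendsto_slope_zero_right ?_
  filter_upwards [hpath.eventually hlow, self_mem_nhdsWithin] with t ht ht0
  simpa [hreal] using mul_nonneg (inv_pos.2 (mem_Ioi.1 ht0)).le (neg_nonneg.2 ht)

variable {h : ℂ → ℂ} {a b : ℝ}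

lemma monotoneOn_re_of_im_nonpos (hd : ∀ x ∈ Icc a b, DifferentiableAt ℂ h x)
    (hreal : ∀ x ∈ Ioo a b, (h x).im = 0)
    (hlow : ∀ x ∈ Ioo a b, ∀ᶠ z in 𝓝[{z | z.im < 0}] (x : ℂ), (h z).im ≤ 0) :
    MonotoneOn (fun x : ℝ => (h x).re) (Icc a b) := by
  have hderiv : ∀ x ∈ Icc a b, HasDerivAt (fun x : ℝ => (h x).re) (deriv h x).re x := fun x hx =>
    (hd x hx).hasDerivAt.real_of_complex
  refine monotoneOn_of_deriv_nonneg (convex_Icc a b)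
    (fun x hx => (hderiv x hx).continuousAt.continuousWithinAt)
    (fun x hx => (hderiv x (interior_subset hx)).differentiableAt.differentiableWithinAt)
    fun x hx => ?_
  have hx' := interior_subset hx
  rw [interior_Icc] at hx
  rw [(hderiv x hx').deriv]
  exact re_deriv_nonneg_of_im_nonpos (hd x hx') (hreal x hx) (hlow x hx)

lemma eqOn_of_eqOn_ofReal {f g : ℂ → ℂ} {U : Set ℂ} (hf : AnalyticOnNhd ℂ f U)
    (hg : AnalyticOnNhd ℂ g U) (hU : IsPreconnected U) {s : Set ℝ} {x : ℝ} (hx : (x : ℂ) ∈ U)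
    (hs : s ∈ 𝓝 x) (heq : ∀ y ∈ s, f y = g y) : EqOn f g U := by
  have hreal : Tendsto Complex.ofReal (𝓝[≠] x) (𝓝[≠] (x : ℂ)) :=
    Complex.continuous_ofReal.continuousWithinAt.tendsto_nhdsWithin fun y hy => by
      simpa using hy
  exact hf.eqOn_of_preconnected_of_frequently_eq hg hU hx
    (hreal.frequently (Eventually.mono (nhdsWithin_le_nhds hs) heq).frequently)

/- Were `re h` to take the same value twice, `h` would be constant by the identity theorem. -/
lemma strictMonoOn_re_of_im_neg (hd : ∀ x : ℂ, ‖x‖ ≤ 1 → DifferentiableAt ℂ h x)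
    (hreal : ∀ x ∈ Icc (-1 : ℝ) 1, (h x).im = 0)
    (hlow : ∀ x : ℂ, ‖x‖ < 1 → x.im < 0 → (h x).im < 0) :
    StrictMonoOn (fun x : ℝ => (h x).re) (Icc (-1) 1) := by
  have hball : ∀ x ∈ Ioo (-1 : ℝ) 1, ‖(x : ℂ)‖ < 1 := fun x hx => by
    simpa using abs_lt.2 hx
  have hmono : MonotoneOn (fun x : ℝ => (h x).re) (Icc (-1) 1) := by
    refine monotoneOn_re_of_im_nonpos (fun x hx => hd x (by simpa using abs_le.2 hx))
      (fun x hx => hreal x (Ioo_subset_Icc_self hx)) fun x hx => ?_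
    filter_upwards [nhdsWithin_le_nhds (continuous_norm.continuousAt.eventually_lt
      continuousAt_const (hball x hx)), self_mem_nhdsWithin] with z hz1 hz2
      using (hlow z hz1 hz2).le
  refine hmono.strictMonoOn_of_injOn fun s hs t ht hst => ?_
  by_contra hne
  wlog hlt : s < t generalizing s t
  · exact this t ht s hs hst.symm (Ne.symm hne) (lt_of_le_of_ne (not_lt.1 hlt) (Ne.symm hne))
  have hconst : ∀ r ∈ Ioo s t, h r = h s := fun r hr => by
    have hr' : r ∈ Icc (-1 : ℝ) 1 := ⟨hs.1.trans hr.1.le, hr.2.le.trans ht.2⟩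
    exact Complex.ext (le_antisymm ((hmono hr' ht hr.2.le).trans_eq hst.symm)
      (hmono hs hr' hr.1.le)) ((hreal r hr').trans (hreal s hs).symm)
  obtain ⟨r, hr⟩ := exists_between hlt
  have hanalytic : AnalyticOnNhd ℂ h (Metric.ball 0 1) :=
    DifferentiableOn.analyticOnNhd (fun z hz =>
      (hd z (mem_ball_zero_iff.1 hz).le).differentiableWithinAt) Metric.isOpen_ball
  have heq := eqOn_of_eqOn_ofReal hanalytic analyticOnNhd_const
    (convex_ball (0 : ℂ) 1).isPreconnected
    (mem_ball_zero_iff.2 (hball r ⟨hs.1.trans_lt hr.1, hr.2.trans_le ht.2⟩))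
    (Ioo_mem_nhds hr.1 hr.2) hconst
  have hhalf : ‖(-Complex.I / 2 : ℂ)‖ < 1 := by norm_num
  have hneg := hlow _ hhalf (by norm_num)
  rw [heq (mem_ball_zero_iff.2 hhalf), hreal s hs] at hneg
  exact lt_irrefl _ hneg

end ImaginaryPart

noncomputable section

open Matrix

section QuadraticForm

variable {n : Type*}

/-- The Hermitian matrix `i (A - A^*)`, which is `-2` times the imaginary part of `A`. -/
def negImagPart (A : Matrix n n ℂ) : Matrix n n ℂ := Complex.I • (A - Aᴴ)

lemma isHermitian_negImagPart (A : Matrix n n ℂ) : (negImagPart A).IsHermitian := by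
  simp only [negImagPart, IsHermitian, conjTranspose_smul, conjTranspose_sub,
    conjTranspose_conjTranspose, Complex.star_def, Complex.conj_I, neg_smul, ← smul_neg, neg_sub]

lemma negImagPart_eq_zero_iff {A : Matrix n n ℂ} : negImagPart A = 0 ↔ A.IsHermitian := by
  rw [negImagPart, smul_eq_zero_iff_right Complex.I_ne_zero, sub_eq_zero, IsHermitian, eq_comm]

variable [Fintype n]

/-- The quadratic form `v^* A v`. -/
def quadForm (A : Matrix n n ℂ) (v : n → ℂ) : ℂ := star v ⬝ᵥ A *ᵥ v

lemma quadForm_conjTranspose (A : Matrix n n ℂ) (v : n → ℂ) :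
    quadForm Aᴴ v = star (quadForm A v) := by
  rw [quadForm, quadForm, ← star_dotProduct_star, star_star, star_mulVec, dotProduct_comm,
    ← dotProduct_mulVec, dotProduct_comm]

lemma quadForm_sub (A B : Matrix n n ℂ) (v : n → ℂ) :
    quadForm (A - B) v = quadForm A v - quadForm B v := by
  simp only [quadForm, sub_mulVec, dotProduct_sub]

lemma im_quadForm_eq_zero {A : Matrix n n ℂ} (hA : A.IsHermitian) (v : n → ℂ) :
    (quadForm A v).im = 0 := by
  rw [← Complex.conj_eq_iff_im, starRingEnd_apply, ← quadForm_conjTranspose, hA.eq]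

lemma posSemidef_iff_re_quadForm_nonneg {A : Matrix n n ℂ} (hA : A.IsHermitian) :
    A.PosSemidef ↔ ∀ v, 0 ≤ (quadForm A v).re :=
  ⟨fun h v => (Complex.le_def.1 (h.dotProduct_mulVec_nonneg v)).1, fun h =>
    .of_dotProduct_mulVec_nonneg hA fun v =>
      Complex.le_def.2 ⟨h v, (im_quadForm_eq_zero hA v).symm⟩⟩

lemma posDef_iff_re_quadForm_pos {A : Matrix n n ℂ} (hA : A.IsHermitian) :
    A.PosDef ↔ ∀ v, v ≠ 0 → 0 < (quadForm A v).re :=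
  ⟨fun h _ hv => (Complex.lt_def.1 (h.dotProduct_mulVec_pos hv)).1, fun h =>
    .of_dotProduct_mulVec_pos hA fun v hv =>
      Complex.lt_def.2 ⟨h v hv, (im_quadForm_eq_zero hA v).symm⟩⟩

lemma re_quadForm_negImagPart (A : Matrix n n ℂ) (v : n → ℂ) :
    (quadForm (negImagPart A) v).re = -2 * (quadForm A v).im := by
  have h : quadForm (negImagPart A) v = Complex.I * (quadForm A v - star (quadForm A v)) := by
    rw [← quadForm_conjTranspose, ← quadForm_sub]
    simp only [quadForm, negImagPart, smul_mulVec, dotProduct_smul, smul_eq_mul]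
  rw [h, Complex.I_mul_re, Complex.sub_im, Complex.star_def, Complex.conj_im]
  ring

lemma posSemidef_negImagPart_iff {A : Matrix n n ℂ} :
    (negImagPart A).PosSemidef ↔ ∀ v, (quadForm A v).im ≤ 0 := by
  rw [posSemidef_iff_re_quadForm_nonneg (isHermitian_negImagPart A)]
  refine forall_congr' fun v => ?_
  rw [re_quadForm_negImagPart]
  constructor <;> intro h <;> linarith

lemma posDef_negImagPart_iff {A : Matrix n n ℂ} :
    (negImagPart A).PosDef ↔ ∀ v, v ≠ 0 → (quadForm A v).im < 0 := by
  rw [posDef_iff_re_quadForm_pos (isHermitian_negImagPart A)]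
  refine forall₂_congr fun v _ => ?_
  rw [re_quadForm_negImagPart]
  constructor <;> intro h <;> linarith

lemma inner_toLp_mulVec (A : Matrix n n ℂ) (v : n → ℂ) :
    inner ℂ (WithLp.toLp 2 v) (WithLp.toLp 2 (A *ᵥ v)) = quadForm A v := by
  rw [EuclideanSpace.inner_toLp_toLp, dotProduct_comm, quadForm]

lemma differentiableAt_quadForm {G : ℂ → Matrix n n ℂ} {x : ℂ} (hG : DifferentiableAt ℂ G x)
    (v : n → ℂ) : DifferentiableAt ℂ (fun y => quadForm (G y) v) x := by
  have hentry : ∀ i j, DifferentiableAt ℂ (fun y => G y i j) x := fun i j =>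
    differentiableAt_pi.1 (differentiableAt_pi.1 hG i) j
  unfold quadForm dotProduct mulVec dotProduct
  fun_prop

open scoped MatrixOrder

lemma monotoneOn_of_quadForm {G : ℝ → Matrix n n ℂ} {s : Set ℝ}
    (hG : ∀ x ∈ s, (G x).IsHermitian)
    (h : ∀ v, MonotoneOn (fun x => (quadForm (G x) v).re) s) : MonotoneOn G s := by
  intro x hx y hy hxy
  rw [Matrix.le_iff, posSemidef_iff_re_quadForm_nonneg ((hG y hy).sub (hG x hx))]
  intro v
  rw [quadForm_sub, Complex.sub_re]
  exact sub_nonneg.2 (h v hx hy hxy)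

open scoped Matrix.Norms.L2Operator in
lemma exists_pos_eventually_im_quadForm_le {A : Matrix n n ℂ} (hA : (negImagPart A).PosDef) :
    ∃ c > 0, ∀ᶠ B in 𝓝 A, ∀ v, (quadForm B v).im ≤ -c * ‖WithLp.toLp 2 v‖ ^ 2 := by
  classical
  obtain ⟨c, hc, h⟩ := exists_pos_eventually_algebraMap_le (isStrictlyPositive_iff_posDef.2 hA)
  have hcont : Continuous (negImagPart : Matrix n n ℂ → Matrix n n ℂ) :=
    (continuous_id.sub continuous_id.matrix_conjTranspose).const_smul Complex.I
  refine ⟨c / 2, half_pos hc, ?_⟩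
  filter_upwards [hcont.continuousAt.eventually h] with B hB v
  have hle := Matrix.le_iff.1 (hB (isHermitian_negImagPart B))
  have hnonneg := (posSemidef_iff_re_quadForm_nonneg hle.isHermitian).1 hle v
  have hnorm : (quadForm (algebraMap ℝ (Matrix n n ℂ) c) v).re = c * ‖WithLp.toLp 2 v‖ ^ 2 := by
    rw [← inner_toLp_mulVec, Algebra.algebraMap_eq_smul_one, smul_mulVec, one_mulVec,
      WithLp.toLp_smul, inner_smul_right_eq_smul, Complex.smul_re, inner_self_eq_norm_sq_to_K]
    norm_cast
  rw [quadForm_sub, Complex.sub_re, re_quadForm_negImagPart, hnorm] at hnonneg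
  linarith

open scoped Matrix.Norms.L2Operator in
lemma exists_nonneg_eventually_norm_mulVec_le (A : Matrix n n ℂ) :
    ∃ β ≥ 0, ∀ᶠ B in 𝓝 A, ∀ v, ‖WithLp.toLp 2 (B *ᵥ v)‖ ≤ β * ‖WithLp.toLp 2 v‖ := by
  classical
  refine ⟨‖A‖ + 1, by positivity, ?_⟩
  filter_upwards [continuous_norm.continuousAt.eventually_lt_const (lt_add_one ‖A‖)] with B hB v
  exact (l2_opNorm_mulVec B (WithLp.toLp 2 v)).trans (by gcongr)

end QuadraticForm

namespace TransferMatrix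

variable {m : ℕ} {G P Q : TransferMatrix m} {x z : ℂ}

section Reciprocal

/-- The numerator of `f (1 / x)` as a polynomial in `x`, for proper `f`. -/
def recipNum (f : RatFunc ℝ) : ℝ[X] := f.num.reflect f.denom.natDegree

/-- The denominator of `f (1 / x)` as a polynomial in `x`, for proper `f`. -/
def recipDen (f : RatFunc ℝ) : ℝ[X] := f.denom.reverse

/-- The value of a proper `G` at `z = 1 / x`, with the value at infinity for `x = 0`. -/
def recipAt (G : TransferMatrix m) (x : ℂ) : Matrix (Fin m) (Fin m) ℂ :=
  G.map fun f => (recipNum f).aeval x / (recipDen f).aeval x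

/-- A proper `G` has no pole at `1 / x`; here `1 / 0` is infinity, where it never has one. -/
def RegularAt (G : TransferMatrix m) (x : ℂ) : Prop :=
  ∀ i j, (recipDen (G i j)).aeval x ≠ 0

lemma coeff_zero_recipDen (f : RatFunc ℝ) : (recipDen f).coeff 0 = 1 := by
  rw [recipDen, Polynomial.coeff_zero_reverse]
  exact f.monic_denom

lemma aeval_recipDen_inv_mul_pow (f : RatFunc ℝ) (hz : z ≠ 0) :
    (recipDen f).aeval z⁻¹ * z ^ f.denom.natDegree = f.denom.aeval z := by
  let _ := invertibleOfNonzero hz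
  simpa only [invOf_eq_inv, Polynomial.aeval_def, recipDen]
    using Polynomial.eval₂_reverse_mul_pow (algebraMap ℝ ℂ) z f.denom

lemma aeval_recipNum_inv_mul_pow {f : RatFunc ℝ} (hf : f.num.degree ≤ f.denom.degree)
    (hz : z ≠ 0) : (recipNum f).aeval z⁻¹ * z ^ f.denom.natDegree = f.num.aeval z := by
  let _ := invertibleOfNonzero hz
  simpa only [invOf_eq_inv, Polynomial.aeval_def, recipNum]
    using Polynomial.eval₂_reflect_mul_pow (algebraMap ℝ ℂ) z
    f.denom.natDegree f.num (Polynomial.natDegree_le_natDegree hf)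

lemma regularAt_zero (G : TransferMatrix m) : G.RegularAt 0 := fun i j => by
  rw [← Polynomial.coeff_zero_eq_aeval_zero', coeff_zero_recipDen, map_one]
  exact one_ne_zero

lemma regularAt_inv (hz : z ≠ 0) (h : ¬ G.IsPole z) : G.RegularAt z⁻¹ := fun i j h0 =>
  h ⟨i, j, by rw [← aeval_recipDen_inv_mul_pow _ hz, h0, zero_mul]⟩

lemma recipAt_inv (hG : G.IsProper) (hz : z ≠ 0) : G.recipAt z⁻¹ = G.valueAt z := by
  ext i j
  rw [valueAt, Matrix.map_apply, RatFunc.eval, ← Polynomial.aeval_def, ← Polynomial.aeval_def,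
    ← aeval_recipDen_inv_mul_pow _ hz, ← aeval_recipNum_inv_mul_pow (hG i j) hz,
    mul_div_mul_right _ _ (pow_ne_zero _ hz)]
  rfl

lemma recipAt_one (hG : G.IsProper) : G.recipAt 1 = G.valueAt 1 := by
  simpa only [inv_one] using recipAt_inv hG one_ne_zero

lemma recipAt_neg_one (hG : G.IsProper) : G.recipAt (-1) = G.valueAt (-1) := by
  simpa only [inv_neg, inv_one] using recipAt_inv hG (neg_ne_zero.2 one_ne_zero)

lemma differentiableAt_recipAt (hx : G.RegularAt x) : DifferentiableAt ℂ G.recipAt x :=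
  differentiableAt_pi.2 fun i => differentiableAt_pi.2 fun j => .fun_div
    (Polynomial.differentiable_aeval _ _) (Polynomial.differentiable_aeval _ _) (hx i j)

lemma continuousAt_recipAt_ofReal {t : ℝ} (ht : G.RegularAt t) :
    ContinuousAt (fun t : ℝ => G.recipAt t) t :=
  (differentiableAt_recipAt ht).continuousAt.comp Complex.continuous_ofReal.continuousAt

lemma isHermitian_recipAt_of_isSymm (hG : G.IsSymm) (hx : x.im = 0) :
    (G.recipAt x).IsHermitian := by
  ext i j
  rw [conjTranspose_apply, recipAt, map_apply, map_apply, hG.apply, Complex.star_def, map_div₀,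
    ← Polynomial.aeval_conj, ← Polynomial.aeval_conj, Complex.conj_eq_iff_im.2 hx]

lemma skewPart_inv (hG : G.IsProper) (hx : x ≠ 0) :
    G.skewPart x⁻¹ = negImagPart (G.recipAt x) := by
  rw [← inv_inv x, recipAt_inv hG (inv_ne_zero hx), inv_inv]
  rfl

end Reciprocal

section NegativeImaginary

lemma im_inv_pos (hx : x.im < 0) : 0 < (x⁻¹).im := by
  have hx0 : x ≠ 0 := fun h => hx.ne (h ▸ Complex.zero_im)
  rw [Complex.inv_im]
  exact div_pos (neg_pos.2 hx) (Complex.normSq_pos.2 hx0)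

lemma one_lt_norm_inv (hx0 : x ≠ 0) (hx : ‖x‖ < 1) : 1 < ‖x⁻¹‖ := by
  rw [norm_inv]
  exact (one_lt_inv₀ (norm_pos_iff.2 hx0)).2 hx

lemma IsDNI.regularAt (hP : P.IsDNI) (hx : ‖x‖ < 1) : P.RegularAt x := by
  rcases eq_or_ne x 0 with rfl | h0
  · exact P.regularAt_zero
  · simpa only [inv_inv] using
      regularAt_inv (inv_ne_zero h0) (hP.analytic _ (one_lt_norm_inv h0 hx))

lemma IsDNI.regularAt_ofReal (hP : P.IsDNI) (hone : ¬ P.IsPole 1) (hnegOne : ¬ P.IsPole (-1))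
    {t : ℝ} (ht : t ∈ Icc (-1 : ℝ) 1) : P.RegularAt t := by
  rcases ht.1.eq_or_lt with rfl | hl
  · simpa using regularAt_inv (neg_ne_zero.2 one_ne_zero) hnegOne
  rcases ht.2.eq_or_lt with rfl | hr
  · simpa using regularAt_inv one_ne_zero hone
  · exact hP.regularAt (by simpa using abs_lt.2 ⟨hl, hr⟩)

lemma IsDNI.im_quadForm_recipAt_nonpos (hP : P.IsDNI) (hprop : P.IsProper) (hx : ‖x‖ < 1)
    (him : x.im < 0) (v : Fin m → ℂ) : (quadForm (P.recipAt x) v).im ≤ 0 := by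
  have hx0 : x ≠ 0 := fun h => him.ne (h ▸ Complex.zero_im)
  have hupper := hP.upper x⁻¹ (one_lt_norm_inv hx0 hx) (im_inv_pos him)
  rw [skewPart_inv hprop hx0] at hupper
  exact posSemidef_negImagPart_iff.1 hupper v

lemma IsDNI.isHermitian_recipAt_ofReal (hP : P.IsDNI) (hprop : P.IsProper) (hone : ¬ P.IsPole 1)
    (hnegOne : ¬ P.IsPole (-1)) {t : ℝ} (ht : t ∈ Icc (-1 : ℝ) 1) : (P.recipAt t).IsHermitian := by
  have hpunctured : EqOn (fun t : ℝ => (P.recipAt t)ᴴ) (fun t : ℝ => P.recipAt t)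
      (Ioo (-1) 1 ∩ {0}ᶜ) := fun t ⟨ht, ht0⟩ => by
    have ht0' : (t : ℂ) ≠ 0 := Complex.ofReal_ne_zero.2 ht0
    have hreal := hP.real (t : ℂ)⁻¹ (one_lt_norm_inv ht0' (by simpa using abs_lt.2 ht))
      (by rw [← Complex.ofReal_inv, Complex.ofReal_im])
    rw [skewPart_inv hprop ht0'] at hreal
    exact negImagPart_eq_zero_iff.1 hreal
  have hcont : ContinuousOn (fun t : ℝ => P.recipAt t) (Icc (-1) 1) := fun t ht =>
    (continuousAt_recipAt_ofReal (hP.regularAt_ofReal hone hnegOne ht)).continuousWithinAt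
  have hdense : Icc (-1 : ℝ) 1 ⊆ closure (Ioo (-1) 1 ∩ {0}ᶜ) := by
    rw [← closure_Ioo (by norm_num : (-1 : ℝ) ≠ 1)]
    exact closure_minimal ((dense_compl_singleton 0).open_subset_closure_inter isOpen_Ioo)
      isClosed_closure
  exact hpunctured.of_subset_closure (continuous_id.matrix_conjTranspose.comp_continuousOn hcont)
    hcont (inter_subset_left.trans Ioo_subset_Icc_self) hdense ht

open scoped MatrixOrder in
lemma IsDNI.monotoneOn_recipAt (hP : P.IsDNI) (hprop : P.IsProper) (hone : ¬ P.IsPole 1)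
    (hnegOne : ¬ P.IsPole (-1)) : MonotoneOn (fun t : ℝ => P.recipAt t) (Icc (-1) 1) := by
  have hherm := fun t ht => hP.isHermitian_recipAt_ofReal hprop hone hnegOne (t := t) ht
  refine monotoneOn_of_quadForm hherm fun v => monotoneOn_re_of_im_nonpos
    (h := fun x => quadForm (P.recipAt x) v)
    (fun t ht => differentiableAt_quadForm
      (differentiableAt_recipAt (hP.regularAt_ofReal hone hnegOne ht)) v)
    (fun t ht => im_quadForm_eq_zero (hherm t (Ioo_subset_Icc_self ht)) v) fun t ht => ?_
  filter_upwards [nhdsWithin_le_nhds (Metric.isOpen_ball.mem_nhds (mem_ball_zero_iff.2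
    (by simpa using abs_lt.2 ht : ‖(t : ℂ)‖ < 1))), self_mem_nhdsWithin] with x hx him
  exact hP.im_quadForm_recipAt_nonpos hprop (mem_ball_zero_iff.1 hx) him v

lemma IsDWSNI.regularAt (hQ : Q.IsDWSNI) (hx : ‖x‖ ≤ 1) : Q.RegularAt x := by
  rcases eq_or_ne x 0 with rfl | h0
  · exact Q.regularAt_zero
  · have hpole : ¬ Q.IsPole x⁻¹ := fun h => (hQ.poles _ h).not_ge (by
      rw [norm_inv]
      exact (one_le_inv₀ (norm_pos_iff.2 h0)).2 hx)
    simpa only [inv_inv] using regularAt_inv (inv_ne_zero h0) hpole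

lemma IsDWSNI.posDef_negImagPart_recipAt (hQ : Q.IsDWSNI) (hprop : Q.IsProper) (hx : ‖x‖ = 1)
    (him : x.im < 0) : (negImagPart (Q.recipAt x)).PosDef := by
  have hpos := im_inv_pos him
  have hx0 : x ≠ 0 := fun h => him.ne (h ▸ Complex.zero_im)
  have harg : Complex.arg x⁻¹ ∈ Ioo 0 Real.pi :=
    ⟨(Complex.arg_nonneg_iff.2 hpos.le).lt_of_ne' fun h => hpos.ne' (Complex.arg_eq_zero_iff.1 h).2,
      (Complex.arg_le_pi _).lt_of_ne fun h => hpos.ne' (Complex.arg_eq_pi_iff.1 h).2⟩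
  have hexp : Complex.exp (Complex.arg x⁻¹ * Complex.I) = x⁻¹ := by
    simpa [hx] using Complex.norm_mul_exp_arg_mul_I x⁻¹
  rw [← skewPart_inv hprop hx0, ← hexp]
  exact hQ.circle _ harg

lemma IsDWSNI.im_quadForm_recipAt_neg (hQ : Q.IsDWSNI) (hprop : Q.IsProper) (hsymm : Q.IsSymm)
    {v : Fin m → ℂ} (hv : v ≠ 0) (hx : ‖x‖ ≤ 1) (him : x.im < 0) :
    (quadForm (Q.recipAt x) v).im < 0 := by
  have hd : ∀ x : ℂ, ‖x‖ ≤ 1 → DifferentiableAt ℂ (fun x => quadForm (Q.recipAt x) v) x :=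
    fun x hx => differentiableAt_quadForm (differentiableAt_recipAt (hQ.regularAt hx)) v
  refine im_neg_of_norm_le_one (h := fun x => quadForm (Q.recipAt x) v)
    (DifferentiableOn.diffContOnCl fun x hx => (hd x ?_).differentiableWithinAt)
    (fun x _ him => (im_quadForm_eq_zero (isHermitian_recipAt_of_isSymm hsymm him) v).le)
    (fun x hx him => posDef_negImagPart_iff.1 (hQ.posDef_negImagPart_recipAt hprop hx him) v hv)
    hx him
  exact mem_closedBall_zero_iff.1 (closure_lowerHalfDisc_subset hx).1

lemma IsDWSNI.strictMonoOn_quadForm_recipAt (hQ : Q.IsDWSNI) (hprop : Q.IsProper)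
    (hsymm : Q.IsSymm) {v : Fin m → ℂ} (hv : v ≠ 0) :
    StrictMonoOn (fun t : ℝ => (quadForm (Q.recipAt t) v).re) (Icc (-1) 1) :=
  strictMonoOn_re_of_im_neg (h := fun x => quadForm (Q.recipAt x) v)
    (fun _ hx => differentiableAt_quadForm (differentiableAt_recipAt (hQ.regularAt hx)) v)
    (fun t _ => im_quadForm_eq_zero (isHermitian_recipAt_of_isSymm hsymm (Complex.ofReal_im t)) v)
    (fun _ hx him => hQ.im_quadForm_recipAt_neg hprop hsymm hv hx.le him)

open scoped MatrixOrder in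
lemma IsDWSNI.monotoneOn_recipAt (hQ : Q.IsDWSNI) (hprop : Q.IsProper) (hsymm : Q.IsSymm) :
    MonotoneOn (fun t : ℝ => Q.recipAt t) (Icc (-1) 1) := by
  refine monotoneOn_of_quadForm
    (fun t _ => isHermitian_recipAt_of_isSymm hsymm (Complex.ofReal_im t)) fun v => ?_
  rcases eq_or_ne v 0 with rfl | hv
  · simp only [quadForm, mulVec_zero, dotProduct_zero]
    exact monotoneOn_const
  · exact (hQ.strictMonoOn_quadForm_recipAt hprop hsymm hv).monotoneOn

lemma IsDWSNI.posDef_recipAt_ofReal (hQ : Q.IsDWSNI) (hprop : Q.IsProper) (hsymm : Q.IsSymm)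
    (hneg : (Q.valueAt (-1)).PosSemidef) {t : ℝ} (ht : t ∈ Ioc (-1 : ℝ) 1) :
    (Q.recipAt t).PosDef := by
  rw [posDef_iff_re_quadForm_pos (isHermitian_recipAt_of_isSymm hsymm (Complex.ofReal_im t))]
  intro v hv
  have hlt := hQ.strictMonoOn_quadForm_recipAt hprop hsymm hv
    (left_mem_Icc.2 (by norm_num)) (Ioc_subset_Icc_self ht) ht.1
  simp only [Complex.ofReal_neg, Complex.ofReal_one, recipAt_neg_one hprop] at hlt
  exact ((posSemidef_iff_re_quadForm_nonneg hneg.isHermitian).1 hneg v).trans_lt hlt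

end NegativeImaginary

end TransferMatrix

section Eigenvalues

variable {m : ℕ} {P Q : TransferMatrix m} {A : Matrix (Fin m) (Fin m) ℂ}

lemma largestEigenvalue_eq_sSup_spectrum (A : Matrix (Fin m) (Fin m) ℂ) :
    largestEigenvalue A = sSup (spectrum ℝ A) :=
  congrArg sSup (Set.ext fun x => spectrum.algebraMap_mem_iff (R := ℝ) ℂ (r := x))

lemma HasOnlyRealEigenvalues.nonempty_spectrum_real (hA : HasOnlyRealEigenvalues A) (hm : 0 < m) :
    (spectrum ℝ A).Nonempty := by
  have : NeZero m := ⟨hm.ne'⟩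
  obtain ⟨μ, hμ⟩ := spectrum.nonempty_of_isAlgClosed_of_finiteDimensional ℂ A
  exact ⟨μ.re, (spectrum.algebraMap_mem_iff ℂ).1
    (by rwa [Complex.coe_algebraMap, Complex.ext (Complex.ofReal_re _) (hA μ hμ).symm])⟩

lemma HasOnlyRealEigenvalues.largestEigenvalue_lt_iff (hA : HasOnlyRealEigenvalues A) (hm : 0 < m)
    {c : ℝ} : largestEigenvalue A < c ↔ ∀ μ ∈ spectrum ℝ A, μ < c := by
  rw [largestEigenvalue_eq_sSup_spectrum]
  exact (Matrix.finite_real_spectrum (A := A)).csSup_lt_iff (hA.nonempty_spectrum_real hm)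

open scoped MatrixOrder Matrix.Norms.L2Operator

lemma hasOnlyRealEigenvalues_mul {B : Matrix (Fin m) (Fin m) ℂ} (hA : A.IsHermitian)
    (hB : B.PosSemidef) : HasOnlyRealEigenvalues (A * B) := fun _ =>
  im_eq_zero_of_mem_spectrum_mul hA (Matrix.nonneg_iff_posSemidef.2 hB)

theorem forall_det_one_sub_ne_zero_iff_spectrum_lt_one (hP : P.IsDNI) (hPprop : P.IsProper)
    (hone : ¬ P.IsPole 1) (hnegOne : ¬ P.IsPole (-1)) (hQ : Q.IsDWSNI) (hQprop : Q.IsProper)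
    (hQsymm : Q.IsSymm) (h₀ : P.valueAt (-1) * Q.valueAt (-1) = 0)
    (hQneg : (Q.valueAt (-1)).PosSemidef) :
    (∀ t ∈ Icc (-1 : ℝ) 1, (1 - P.recipAt t * Q.recipAt t).det ≠ 0) ↔
      ∀ μ ∈ spectrum ℝ (P.valueAt 1 * Q.valueAt 1), μ < 1 := by
  have hQreg : ∀ t ∈ Icc (-1 : ℝ) 1, Q.RegularAt t := fun t ht =>
    hQ.regularAt (by simpa using abs_le.2 ht)
  simpa [isUnit_iff_isUnit_det, P.recipAt_one hPprop, Q.recipAt_one hQprop] using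
    isUnit_one_sub_mul_iff_spectrum_lt_one (by norm_num : (-1 : ℝ) < 1)
      (P := fun t => P.recipAt t) (Q := fun t => Q.recipAt t)
      (fun t ht => (P.continuousAt_recipAt_ofReal
        (hP.regularAt_ofReal hone hnegOne ht)).continuousWithinAt)
      (fun t ht => (Q.continuousAt_recipAt_ofReal (hQreg t ht)).continuousWithinAt)
      (fun t ht => hP.isHermitian_recipAt_ofReal hPprop hone hnegOne ht)
      (hP.monotoneOn_recipAt hPprop hone hnegOne) (hQ.monotoneOn_recipAt hQprop hQsymm)
      (fun t ht => isStrictlyPositive_iff_posDef.2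
        (hQ.posDef_recipAt_ofReal hQprop hQsymm hQneg ht))
      (by simpa [TransferMatrix.recipAt_neg_one, hPprop, hQprop] using h₀)

end Eigenvalues

section Series

open PowerSeries (coeff)

/-- The series with absolutely summable coefficients: the impulse responses of stable systems. -/
def absSummableSeries (𝕜 : Type*) [NormedField 𝕜] : Subsemiring (PowerSeries 𝕜) where
  carrier := {f | Summable fun k => ‖coeff k f‖}
  mul_mem' hf hg := by
    simpa only [mem_ofPred_eq, PowerSeries.coeff_mul] using
      summable_norm_sum_mul_antidiagonal_of_summable_norm hf hg
  one_mem' := summable_of_ne_finset_zero (s := {0}) fun k hk => by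
    rw [PowerSeries.coeff_one, if_neg (by simpa using hk), norm_zero]
  add_mem' hf hg := .of_nonneg_of_le (fun _ => norm_nonneg _) (fun _ => norm_add_le _ _)
    (hf.add hg)
  zero_mem' := by simp [summable_zero]

/-- The series with square summable coefficients: the signals of finite energy. -/
def squareSummableSeries : Submodule ℝ (PowerSeries ℝ) where
  carrier := {f | Summable fun k => coeff k f ^ 2}
  add_mem' hf hg := .of_nonneg_of_le (fun _ => sq_nonneg _) (fun _ => add_sq_le)
    ((hf.add hg).mul_left 2)
  zero_mem' := by simp [summable_zero]
  smul_mem' c f hf := by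
    simpa only [mem_ofPred_eq, PowerSeries.coeff_smul, smul_eq_mul, mul_pow] using
      Summable.mul_left (c ^ 2) hf

lemma mem_squareSummableSeries {f : PowerSeries ℝ} :
    f ∈ squareSummableSeries ↔ Summable fun k => coeff k f ^ 2 := Iff.rfl

lemma tendsto_coeff_of_mem_squareSummableSeries {f : PowerSeries ℝ}
    (hf : f ∈ squareSummableSeries) : Tendsto (fun k => coeff k f) atTop (𝓝 0) := by
  have hsqrt := (mem_squareSummableSeries.1 hf).tendsto_atTop_zero.sqrt
  simp only [Real.sqrt_sq_eq_abs, Real.sqrt_zero] at hsqrt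
  exact (tendsto_zero_iff_abs_tendsto_zero _).2 hsqrt

lemma mul_mem_squareSummableSeries {h u : PowerSeries ℝ} (hh : h ∈ absSummableSeries ℝ)
    (hu : u ∈ squareSummableSeries) : h * u ∈ squareSummableSeries := by
  have hconv : Summable fun n => ‖∑ kl ∈ Finset.HasAntidiagonal.antidiagonal n,
      ‖coeff kl.1 h‖ * coeff kl.2 u ^ 2‖ :=
    summable_norm_sum_mul_antidiagonal_of_summable_norm (f := fun k => ‖coeff k h‖)
      (g := fun k => coeff k u ^ 2) (Summable.norm hh) (Summable.norm hu)
  refine .of_nonneg_of_le (fun k => sq_nonneg _) (fun k => ?_)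
    (hconv.mul_left (∑' k, ‖coeff k h‖))
  have hpartial : ∑ kl ∈ Finset.HasAntidiagonal.antidiagonal k, ‖coeff kl.1 h‖ ≤
      ∑' k, ‖coeff k h‖ := by
    rw [Finset.Nat.sum_antidiagonal_eq_sum_range_succ_mk]
    exact hh.sum_le_tsum (Finset.range k.succ) fun _ _ => norm_nonneg _
  calc coeff k (h * u) ^ 2
      ≤ (∑ kl ∈ Finset.HasAntidiagonal.antidiagonal k, ‖coeff kl.1 h‖) *
        ∑ kl ∈ Finset.HasAntidiagonal.antidiagonal k, ‖coeff kl.1 h‖ * coeff kl.2 u ^ 2 := by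
        rw [PowerSeries.coeff_mul]
        refine Finset.sum_sq_le_sum_mul_sum_of_sq_le_mul _ (fun _ _ => norm_nonneg _)
          (fun _ _ => by positivity) fun _ _ => ?_
        rw [← mul_assoc, Real.norm_eq_abs, abs_mul_abs_self, mul_pow, sq (coeff _ h)]
    _ ≤ _ := mul_le_mul hpartial (Real.le_norm_self _)
        (Finset.sum_nonneg fun _ _ => by positivity) (tsum_nonneg fun _ => norm_nonneg _)

lemma mulVec_mem_squareSummableSeries {ι κ : Type*} [Fintype κ] {A : Matrix ι κ (PowerSeries ℝ)}
    {f : κ → PowerSeries ℝ} (hA : ∀ i j, A i j ∈ absSummableSeries ℝ)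
    (hf : ∀ j, f j ∈ squareSummableSeries) (i : ι) : (A *ᵥ f) i ∈ squareSummableSeries :=
  sum_mem fun j _ => mul_mem_squareSummableSeries (hA i j) (hf j)

section NormedField

variable {𝕜 : Type*} [NormedField 𝕜]

lemma coe_mem_absSummableSeries (p : 𝕜[X]) : (p : PowerSeries 𝕜) ∈ absSummableSeries 𝕜 :=
  summable_of_ne_finset_zero (s := p.support) fun k hk => by
    rw [Polynomial.coeff_coe, Polynomial.notMem_support_iff.1 hk, norm_zero]

lemma inv_X_sub_C_mem_absSummableSeries {r : 𝕜} (hr : 1 < ‖r‖) :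
    ((Polynomial.X - Polynomial.C r : 𝕜[X]) : PowerSeries 𝕜)⁻¹ ∈ absSummableSeries 𝕜 := by
  have hr0 : r ≠ 0 := norm_pos_iff.1 (one_pos.trans hr)
  have hgeom : ((Polynomial.X - Polynomial.C r : 𝕜[X]) : PowerSeries 𝕜)⁻¹ =
      .mk fun k => -(r⁻¹ ^ (k + 1)) := by
    rw [PowerSeries.inv_eq_iff_mul_eq_one (by simpa using hr0)]
    ext k
    rw [Polynomial.coe_sub, Polynomial.coe_X, Polynomial.coe_C, mul_sub, map_sub,
      PowerSeries.coeff_mul_C, PowerSeries.coeff_one]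
    cases k with
    | zero => simp [hr0]
    | succ k =>
      rw [PowerSeries.coeff_succ_mul_X, PowerSeries.coeff_mk, PowerSeries.coeff_mk,
        if_neg k.succ_ne_zero]
      rw [pow_succ _ (k + 1), neg_mul, inv_mul_cancel_right₀ hr0, sub_self]
  rw [hgeom]
  refine ((summable_geometric_of_lt_one (norm_nonneg r⁻¹) ?_).mul_left ‖r⁻¹‖).congr fun k => ?_
  · rw [norm_inv]
    exact inv_lt_one_of_one_lt₀ hr
  · rw [PowerSeries.coeff_mk, norm_neg, norm_pow, pow_succ']

lemma inv_coe_mem_absSummableSeries [IsAlgClosed 𝕜] {p : 𝕜[X]}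
    (hp : ∀ x : 𝕜, ‖x‖ ≤ 1 → p.eval x ≠ 0) :
    (p : PowerSeries 𝕜)⁻¹ ∈ absSummableSeries 𝕜 := by
  have hprod : ∀ s : Multiset 𝕜, (∀ r ∈ s, 1 < ‖r‖) →
      (((s.map fun x => Polynomial.X - Polynomial.C x).prod : 𝕜[X]) : PowerSeries 𝕜)⁻¹ ∈
        absSummableSeries 𝕜 := by
    intro s hs
    induction s using Multiset.induction with
    | empty => simp
    | cons a s ih =>
      rw [Multiset.map_cons, Multiset.prod_cons, Polynomial.coe_mul, PowerSeries.mul_inv_rev]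
      exact mul_mem (ih fun r hr => hs r (Multiset.mem_cons_of_mem hr))
        (inv_X_sub_C_mem_absSummableSeries (hs a (Multiset.mem_cons_self a s)))
  rw [(IsAlgClosed.splits p).eq_prod_roots, Polynomial.coe_mul, PowerSeries.mul_inv_rev]
  refine mul_mem (hprod _ fun r hr => ?_) ?_
  · by_contra! hle
    exact hp r hle (Polynomial.isRoot_of_mem_roots hr)
  · rw [Polynomial.coe_C, PowerSeries.C_inv, ← Polynomial.coe_C]
    exact coe_mem_absSummableSeries _

/-- Multiplying by `X - x` telescopes: the partial sums of `r` at `x` are `-x ^ (n + 1) * Fₙ`. -/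
lemma eval_eq_zero_of_X_sub_C_mul_eq {F : PowerSeries 𝕜} {r : 𝕜[X]} {x : 𝕜} (hx : ‖x‖ ≤ 1)
    (hF : Tendsto (fun n => coeff n F) atTop (𝓝 0))
    (h : ((Polynomial.X - Polynomial.C x : 𝕜[X]) : PowerSeries 𝕜) * F = r) : r.eval x = 0 := by
  have hcoeff : ∀ k, r.coeff k = coeff k (PowerSeries.X * F) - x * coeff k F := fun k => by
    rw [← Polynomial.coeff_coe, ← h, Polynomial.coe_sub, Polynomial.coe_X, Polynomial.coe_C,
      sub_mul, map_sub, PowerSeries.coeff_C_mul]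
  have hpartial : ∀ n, ∑ k ∈ Finset.range (n + 1), r.coeff k * x ^ k =
      -(x ^ (n + 1) * coeff n F) := by
    intro n
    induction n with
    | zero => simp [hcoeff]
    | succ n ih =>
      rw [Finset.sum_range_succ, ih, hcoeff, PowerSeries.coeff_succ_X_mul]
      ring
  have hbound : ∀ᶠ n in atTop, ‖r.eval x‖ ≤ ‖coeff n F‖ := by
    filter_upwards [eventually_ge_atTop r.natDegree] with n hn
    rw [Polynomial.eval_eq_sum_range' (Nat.lt_succ_of_le hn), hpartial, norm_neg, norm_mul,
      norm_pow]
    exact mul_le_of_le_one_left (norm_nonneg _) (pow_le_one₀ (norm_nonneg _) hx)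
  exact norm_le_zero_iff.1 (ge_of_tendsto (tendsto_zero_iff_norm_tendsto_zero.1 hF) hbound)

end NormedField

lemma exists_ne_zero_dotProduct_eval_eq_zero {n : Type*} [Fintype n] [DecidableEq n]
    {A : Matrix n n ℝ[X]} {x : ℝ} (hx : |x| ≤ 1) (hA : A.det.eval x = 0) :
    ∃ y : n → ℝ, y ≠ 0 ∧ ∀ (F : n → PowerSeries ℝ) (r : n → ℝ[X]),
      (∀ i, F i ∈ squareSummableSeries) →
      A.map Polynomial.coeToPowerSeries.ringHom *ᵥ F =
        Polynomial.coeToPowerSeries.ringHom ∘ r →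
      ∑ i, y i * (r i).eval x = 0 := by
  have hdet : (A.map (Polynomial.evalRingHom x)).det = 0 := by
    rw [← RingHom.mapMatrix_apply, ← RingHom.map_det, Polynomial.coe_evalRingHom, hA]
  obtain ⟨y, hy₀, hy⟩ := exists_vecMul_eq_zero_iff.2 hdet
  have hdvd : ∀ l, (Polynomial.X - Polynomial.C x) ∣ ∑ i, Polynomial.C (y i) * A i l := fun l =>
    Polynomial.dvd_iff_isRoot.2 <| by
      simpa [vecMul, dotProduct, Polynomial.eval_finsetSum] using congrFun hy l
  choose q hq using hdvd
  refine ⟨y, hy₀, fun F r hF hr => ?_⟩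
  have hroot : ((Polynomial.X - Polynomial.C x : ℝ[X]) : PowerSeries ℝ) *
      ∑ l, (q l : PowerSeries ℝ) * F l =
        ((∑ i, Polynomial.C (y i) * r i : ℝ[X]) : PowerSeries ℝ) := by
    simp only [← Polynomial.coeToPowerSeries.ringHom_apply]
    calc _ = ∑ l, ∑ i, Polynomial.coeToPowerSeries.ringHom (Polynomial.C (y i)) *
          (Polynomial.coeToPowerSeries.ringHom (A i l) * F l) := by
          simp only [Finset.mul_sum, ← mul_assoc, ← map_mul, ← Finset.sum_mul, ← map_sum, hq]
      _ = ∑ i, Polynomial.coeToPowerSeries.ringHom (Polynomial.C (y i)) *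
          (A.map Polynomial.coeToPowerSeries.ringHom *ᵥ F) i := by
          rw [Finset.sum_comm]
          simp only [mulVec, dotProduct, Finset.mul_sum, map_apply]
      _ = _ := by simp only [hr, Function.comp_apply, map_sum, map_mul]
  have hsquare : ∑ l, (q l : PowerSeries ℝ) * F l ∈ squareSummableSeries :=
    sum_mem fun l _ => mul_mem_squareSummableSeries (coe_mem_absSummableSeries (q l)) (hF l)
  simpa [Polynomial.eval_finsetSum] using
    eval_eq_zero_of_X_sub_C_mul_eq hx (tendsto_coeff_of_mem_squareSummableSeries hsquare) hroot

lemma mul_inv_mem_absSummableSeries (a : ℝ[X]) {b : ℝ[X]}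
    (hb : ∀ x : ℂ, ‖x‖ ≤ 1 → b.aeval x ≠ 0) :
    (a : PowerSeries ℝ) * (b : PowerSeries ℝ)⁻¹ ∈ absSummableSeries ℝ := by
  refine mul_mem (coe_mem_absSummableSeries a) ?_
  have hb0 : b.coeff 0 ≠ 0 := fun h => hb 0 (by simp) (by
    rw [← Polynomial.coeff_zero_eq_aeval_zero', h, map_zero])
  have hmap : PowerSeries.map (algebraMap ℝ ℂ) (b : PowerSeries ℝ)⁻¹ =
      ((b.map (algebraMap ℝ ℂ) : ℂ[X]) : PowerSeries ℂ)⁻¹ := by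
    rw [eq_comm, PowerSeries.inv_eq_iff_mul_eq_one, Polynomial.polynomial_map_coe, ← map_mul,
      PowerSeries.inv_mul_cancel, map_one]
    · rwa [Polynomial.constantCoeff_coe]
    · rwa [Polynomial.constantCoeff_coe, Polynomial.coeff_map,
        map_ne_zero]
  have hcomplex := inv_coe_mem_absSummableSeries (p := b.map (algebraMap ℝ ℂ)) fun x hx => by
    rw [Polynomial.eval_map_algebraMap]
    exact hb x hx
  rw [← hmap] at hcomplex
  simpa [absSummableSeries] using hcomplex

lemma eventually_aeval_ne_zero {g : ℝ[X]} (hg : g ≠ 0) (x : ℂ) : ∀ᶠ y in 𝓝[≠] x, g.aeval y ≠ 0 :=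
  nhdsNE_le_cofinite x <| (g.rootSet_finite ℂ).subset fun _ hy =>
    (Polynomial.mem_rootSet_of_ne hg).2 (not_not.1 hy)

lemma aeval_ne_zero_of_isBigO {a b g : ℝ[X]} (hab : IsCoprime a b) (hg : g ≠ 0) {s : Set ℂ} {x : ℂ}
    (hx : AccPt x (𝓟 s)) (h : (fun y => (g * a).aeval y) =O[𝓝[s] x] fun y => (g * b).aeval y) :
    b.aeval x ≠ 0 := by
  intro hbx
  have hx' : (𝓝[≠] x ⊓ 𝓟 s).NeBot := hx
  have hcancel : (fun y => a.aeval y) =O[𝓝[≠] x ⊓ 𝓟 s] fun y => b.aeval y := by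
    obtain ⟨K, hK⟩ := h.bound
    refine .of_bound K ?_
    filter_upwards [hK.filter_mono (inf_le_inf_right _ nhdsWithin_le_nhds),
      (eventually_aeval_ne_zero hg x).filter_mono inf_le_left] with y hy hgy
    rw [map_mul, map_mul, norm_mul, norm_mul, mul_left_comm] at hy
    exact le_of_mul_le_mul_left hy (norm_pos_iff.2 hgy)
  have hlim : ∀ p : ℝ[X], Tendsto (fun y => p.aeval y) (𝓝[≠] x ⊓ 𝓟 s) (𝓝 (p.aeval x)) := fun p =>
    (p.continuous_aeval.tendsto x).mono_left (inf_le_left.trans nhdsWithin_le_nhds)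
  have hax : a.aeval x = 0 :=
    tendsto_nhds_unique (hlim a) (hcancel.trans_tendsto (by simpa only [hbx] using hlim b))
  obtain ⟨u, v, huv⟩ := hab
  simpa [hax, hbx] using congrArg (Polynomial.aeval x) huv

lemma mul_inv_mem_absSummableSeries_of_isBigO {a b : ℝ[X]} (hb₀ : b.coeff 0 ≠ 0)
    (h : ∀ x : ℂ, ‖x‖ ≤ 1 → x.im ≤ 0 → b.aeval x = 0 →
      (fun y => a.aeval y) =O[𝓝[Metric.ball 0 1] x] fun y => b.aeval y) :
    (a : PowerSeries ℝ) * (b : PowerSeries ℝ)⁻¹ ∈ absSummableSeries ℝ := by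
  obtain ⟨a', b', ha, hb, hunit⟩ := extract_gcd a b
  have hcop : IsCoprime a' b' := (gcd_isUnit_iff a' b').1 hunit
  set g := gcd a b
  have hg₀ : g.coeff 0 ≠ 0 := by
    rw [hb, Polynomial.mul_coeff_zero] at hb₀
    exact left_ne_zero_of_mul hb₀
  have hquot : (a : PowerSeries ℝ) * (b : PowerSeries ℝ)⁻¹ =
      (a' : PowerSeries ℝ) * (b' : PowerSeries ℝ)⁻¹ := by
    have hcancel : (g : PowerSeries ℝ) * (g : PowerSeries ℝ)⁻¹ = 1 :=
      PowerSeries.mul_inv_cancel _ (by rwa [Polynomial.constantCoeff_coe])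
    rw [ha, hb, Polynomial.coe_mul, Polynomial.coe_mul, PowerSeries.mul_inv_rev]
    linear_combination ((a' : PowerSeries ℝ) * (b' : PowerSeries ℝ)⁻¹) * hcancel
  have hlower : ∀ x : ℂ, ‖x‖ ≤ 1 → x.im ≤ 0 → b'.aeval x ≠ 0 := by
    intro x hx him hroot
    have hacc : AccPt x (𝓟 (Metric.ball 0 1)) := UniqueDiffWithinAt.accPt (𝕜 := ℝ) <|
      uniqueDiffWithinAt_convex (convex_ball 0 1) (by simp [Metric.isOpen_ball.interior_eq])
        (by simpa [closure_ball (0 : ℂ) one_ne_zero] using hx)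
    have hbig := h x hx him (by rw [hb, map_mul, hroot, mul_zero])
    rw [ha, hb] at hbig
    exact aeval_ne_zero_of_isBigO hcop (fun h => hg₀ (by rw [h, Polynomial.coeff_zero])) hacc
      hbig hroot
  rw [hquot]
  refine mul_inv_mem_absSummableSeries a' fun x hx hroot => ?_
  rcases le_total x.im 0 with him | him
  · exact hlower x hx him hroot
  · refine hlower (starRingEnd ℂ x) (by simpa using hx) (by simpa using him) ?_
    rw [Polynomial.aeval_conj, hroot, map_zero]

end Series

section Feedback

lemma norm_le_of_feedback {E : Type*} [NormedAddCommGroup E] [InnerProductSpace ℂ E]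
    {w₁ w₂ e₁ e₂ y₁ y₂ : E} {c β W : ℝ} (hc : 0 < c) (hβ : 0 ≤ β) (he₁ : e₁ = w₁ + y₂)
    (he₂ : e₂ = w₂ + y₁) (hy₁ : (inner ℂ e₁ y₁).im ≤ 0) (hy₂ : (inner ℂ e₂ y₂).im ≤ -c * ‖e₂‖ ^ 2)
    (hy₂_norm : ‖y₂‖ ≤ β * ‖e₂‖) (hw₁ : ‖w₁‖ ≤ W) (hw₂ : ‖w₂‖ ≤ W) :
    ‖e₂‖ ≤ (1 + (β + 2) / c) * W := by
  have hW : 0 ≤ W := (norm_nonneg _).trans hw₁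
  have hK : 0 ≤ (β + 2) / c * W := by positivity
  rcases le_or_gt ‖e₂‖ W with hle | hlt
  · linarith
  have hantisymm : (inner ℂ e₁ e₂).im = -(inner ℂ e₂ e₁).im := by
    rw [← inner_conj_symm, Complex.conj_im]
  have hsplit₁ : (inner ℂ e₁ e₂).im = (inner ℂ e₁ w₂).im + (inner ℂ e₁ y₁).im := by
    rw [← Complex.add_im, ← inner_add_right, ← he₂]
  have hsplit₂ : (inner ℂ e₂ e₁).im = (inner ℂ e₂ w₁).im + (inner ℂ e₂ y₂).im := by
    rw [← Complex.add_im, ← inner_add_right, ← he₁]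
  have hbound : ∀ u v : E, ‖v‖ ≤ W → (inner ℂ u v).im ≤ ‖u‖ * W := fun u v hv =>
    (Complex.abs_im_le_norm _).trans' (le_abs_self _) |>.trans <|
      (norm_inner_le_norm u v).trans (by gcongr)
  have he₁_norm : ‖e₁‖ ≤ (1 + β) * ‖e₂‖ := by
    rw [he₁]
    linarith [norm_add_le w₁ y₂]
  have henergy : c * ‖e₂‖ * ‖e₂‖ ≤ (β + 2) * W * ‖e₂‖ := by
    calc c * ‖e₂‖ * ‖e₂‖ ≤ ‖e₁‖ * W + ‖e₂‖ * W := by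
          linarith [hbound e₁ w₂ hw₂, hbound e₂ w₁ hw₁]
      _ ≤ (1 + β) * ‖e₂‖ * W + ‖e₂‖ * W := by gcongr
      _ = (β + 2) * W * ‖e₂‖ := by ring
  have hdiv : ‖e₂‖ ≤ (β + 2) / c * W := by
    rw [div_mul_eq_mul_div, le_div_iff₀' hc]
    exact le_of_mul_le_mul_right henergy (hW.trans_lt hlt)
  linarith

lemma norm_toLp_comp_le {ι κ : Type*} [Fintype ι] [Fintype κ] {f : κ → ι}
    (hf : Function.Injective f) (w : ι → ℂ) :
    ‖WithLp.toLp 2 (w ∘ f)‖ ≤ ‖WithLp.toLp 2 w‖ := by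
  rw [EuclideanSpace.norm_eq, EuclideanSpace.norm_eq]
  refine Real.sqrt_le_sqrt ?_
  calc ∑ k, ‖w (f k)‖ ^ 2 = ∑ i ∈ Finset.univ.map ⟨f, hf⟩, ‖w i‖ ^ 2 := by rw [Finset.sum_map]; rfl
    _ ≤ ∑ i, ‖w i‖ ^ 2 := Finset.sum_le_univ_sum_of_nonneg fun _ => sq_nonneg _

variable {n R : Type*} [Fintype n] [DecidableEq n] [CommRing R] {A B : Matrix n n R}
  {w₁ w₂ f₁ f₂ : n → R}

lemma feedback_iff : f₁ = w₁ + B *ᵥ f₂ ∧ f₂ = w₂ + A *ᵥ f₁ ↔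
    f₁ = w₁ + B *ᵥ f₂ ∧ (1 - A * B) *ᵥ f₂ = fromCols A 1 *ᵥ Sum.elim w₁ w₂ := by
  refine and_congr_right fun h₁ => ?_
  rw [h₁, fromCols_mulVec_sumElim, sub_mulVec, one_mulVec, one_mulVec, ← mulVec_mulVec,
    sub_eq_iff_eq_add, mulVec_add, add_comm (A *ᵥ w₁) w₂, add_assoc]

lemma existsUnique_feedback (h : IsUnit (1 - A * B)) (w₁ w₂ : n → R) :
    ∃! f : (n → R) × (n → R), f.1 = w₁ + B *ᵥ f.2 ∧ f.2 = w₂ + A *ᵥ f.1 := by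
  simp only [feedback_iff]
  obtain ⟨f₂, hf₂⟩ := mulVec_surjective_iff_isUnit.2 h (fromCols A 1 *ᵥ Sum.elim w₁ w₂)
  refine ⟨(w₁ + B *ᵥ f₂, f₂), ⟨rfl, hf₂⟩, ?_⟩
  rintro ⟨g₁, g₂⟩ ⟨hg₁, hg₂⟩
  obtain rfl : g₂ = f₂ := mulVec_injective_of_isUnit h (hg₂.trans hf₂.symm)
  exact Prod.ext hg₁ rfl

end Feedback

namespace TransferMatrix

variable {m : ℕ} {G P Q : TransferMatrix m} {x : ℂ}

section CommonDenominator

/-- A common denominator of the entries of `G`, as a polynomial in `1 / z`. -/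
def commonDen (G : TransferMatrix m) : ℝ[X] := ∏ p : Fin m × Fin m, recipDen (G p.1 p.2)

/-- The numerators of the entries of `G` over `commonDen G`, as polynomials in `1 / z`. -/
def commonNum (G : TransferMatrix m) : Matrix (Fin m) (Fin m) ℝ[X] :=
  .of fun i j => recipNum (G i j) * ∏ p ∈ Finset.univ.erase (i, j), recipDen (G p.1 p.2)

/-- The return difference `1 - P Q` with denominators cleared, in the variable `1 / z`. -/
def loopMatrix (P Q : TransferMatrix m) : Matrix (Fin m) (Fin m) ℝ[X] :=
  (P.commonDen * Q.commonDen) • 1 - P.commonNum * Q.commonNum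

/-- Eliminating `e₁` from the loop equations gives `(1 - P Q) e₂ = P w₁ + w₂`; this is the matrix
`[P 1]` acting on `(w₁, w₂)`, with the denominators of `loopMatrix P Q` cleared. -/
def inputMatrix (P Q : TransferMatrix m) : Matrix (Fin m) (Fin m ⊕ Fin m) ℝ[X] :=
  fromCols (Q.commonDen • P.commonNum) ((P.commonDen * Q.commonDen) • 1)

/-- The numerators of the closed-loop transfer matrix `(1 - P Q)⁻¹ [P 1]` from `(w₁, w₂)` to `e₂`
over the denominator `det (loopMatrix P Q)`. -/
def closedLoopNum (P Q : TransferMatrix m) : Matrix (Fin m) (Fin m ⊕ Fin m) ℝ[X] :=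
  (loopMatrix P Q).adjugate * inputMatrix P Q

section Specialization

variable {S : Type*} [CommRing S] {φ : ℝ[X] →+* S} {A B : Matrix (Fin m) (Fin m) S}

lemma map_commonNum (hA : ∀ i j, A i j * φ (recipDen (G i j)) = φ (recipNum (G i j))) :
    G.commonNum.map φ = φ G.commonDen • A := by
  ext i j
  rw [map_apply, commonNum, of_apply, map_mul, ← hA, Matrix.smul_apply, smul_eq_mul, mul_assoc,
    ← map_mul, Finset.mul_prod_erase Finset.univ (fun p => recipDen (G p.1 p.2))
    (Finset.mem_univ (i, j)), mul_comm]
  rfl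

lemma map_smul_one (φ : ℝ[X] →+* S) (p : ℝ[X]) :
    (p • (1 : Matrix (Fin m) (Fin m) ℝ[X])).map φ = φ p • 1 := by
  rw [Matrix.map_smul' _ _ _ (map_mul φ), Matrix.map_one φ φ.map_zero φ.map_one]

lemma map_loopMatrix (hA : P.commonNum.map φ = φ P.commonDen • A)
    (hB : Q.commonNum.map φ = φ Q.commonDen • B) :
    (loopMatrix P Q).map φ = φ (P.commonDen * Q.commonDen) • (1 - A * B) := by
  rw [loopMatrix, Matrix.map_sub φ (map_sub φ), map_smul_one, Matrix.map_mul, hA, hB, smul_mul_smul,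
    map_mul, smul_sub]

lemma map_inputMatrix (hA : P.commonNum.map φ = φ P.commonDen • A) :
    (inputMatrix P Q).map φ = φ (P.commonDen * Q.commonDen) • fromCols A 1 := by
  rw [inputMatrix, fromCols_map, map_smul_one, Matrix.map_smul' _ _ _ (map_mul φ), hA, smul_smul,
    ← map_mul, mul_comm Q.commonDen]
  ext i (j | j) <;> rfl

lemma det_smul_eq_closedLoopNum_mulVec (hA : P.commonNum.map φ = φ P.commonDen • A)
    (hB : Q.commonNum.map φ = φ Q.commonDen • B) {f : Fin m → S} {w : Fin m ⊕ Fin m → S}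
    (h : (1 - A * B) *ᵥ f = fromCols A 1 *ᵥ w) :
    φ (loopMatrix P Q).det • f = (closedLoopNum P Q).map φ *ᵥ w := by
  rw [closedLoopNum, Matrix.map_mul, ← mulVec_mulVec, map_inputMatrix hA, smul_mulVec, ← h,
    ← smul_mulVec, ← map_loopMatrix hA hB, mulVec_mulVec, ← Matrix.map_mul, adjugate_mul,
    map_smul_one, smul_mulVec, one_mulVec]

lemma one_sub_mul_mulVec_closedLoopNum (hA : P.commonNum.map φ = φ P.commonDen • A)
    (hB : Q.commonNum.map φ = φ Q.commonDen • B)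
    (hden : IsRegular (φ (P.commonDen * Q.commonDen))) (w : Fin m ⊕ Fin m → S) :
    (1 - A * B) *ᵥ ((closedLoopNum P Q).map φ *ᵥ w) =
      fromCols A 1 *ᵥ (φ (loopMatrix P Q).det • w) := by
  have hsmul : φ (P.commonDen * Q.commonDen) • (1 - A * B) *ᵥ ((closedLoopNum P Q).map φ *ᵥ w) =
      φ (P.commonDen * Q.commonDen) • fromCols A 1 *ᵥ (φ (loopMatrix P Q).det • w) := by
    rw [← smul_mulVec, ← smul_mulVec, ← map_loopMatrix hA hB, ← map_inputMatrix (Q := Q) hA,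
      closedLoopNum, mulVec_mulVec, Matrix.map_mul, ← Matrix.mul_assoc, ← Matrix.map_mul,
      mul_adjugate, map_smul_one, Matrix.smul_mul, Matrix.one_mul, smul_mulVec, mulVec_smul]
  exact IsSMulRegular.pi (fun _ => hden.left.isSMulRegular) hsmul

end Specialization

lemma aeval_commonDen_ne_zero (hx : G.RegularAt x) : G.commonDen.aeval x ≠ 0 := by
  rw [commonDen, map_prod]
  exact Finset.prod_ne_zero_iff.2 fun p _ => hx p.1 p.2

lemma map_aeval_commonNum (hx : G.RegularAt x) :
    G.commonNum.map (Polynomial.aeval (R := ℝ) x).toRingHom =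
      (Polynomial.aeval (R := ℝ) x).toRingHom G.commonDen • G.recipAt x :=
  map_commonNum fun i j => div_mul_cancel₀ _ (hx i j)

lemma aeval_det_loopMatrix_eq_zero_iff (hP : P.RegularAt x) (hQ : Q.RegularAt x) :
    (loopMatrix P Q).det.aeval x = 0 ↔ (1 - P.recipAt x * Q.recipAt x).det = 0 := by
  have hdet := congrArg det (map_loopMatrix (map_aeval_commonNum hP) (map_aeval_commonNum hQ))
  rw [det_smul, ← RingHom.mapMatrix_apply, ← RingHom.map_det] at hdet
  simp only [AlgHom.toRingHom_eq_coe, RingHom.coe_coe, map_mul] at hdet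
  rw [hdet, mul_eq_zero_iff_left]
  exact pow_ne_zero _ (mul_ne_zero (aeval_commonDen_ne_zero hP) (aeval_commonDen_ne_zero hQ))

end CommonDenominator

variable {u w₁ w₂ e₁ e₂ : Signal m}

section GeneratingFunctions

open PowerSeries (coeff)

/-- The expansion of a proper `G` in powers of `1 / z`. -/
def impulseMatrix (G : TransferMatrix m) : Matrix (Fin m) (Fin m) (PowerSeries ℝ) :=
  G.map fun f => (recipNum f : PowerSeries ℝ) * (recipDen f : PowerSeries ℝ)⁻¹

/-- The generating functions of the components of a signal: its `z`-transform in the variable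
`1 / z`. -/
def genFun : Signal m ≃+ (Fin m → PowerSeries ℝ) where
  toFun u i := .mk fun k => u k i
  invFun f k i := coeff k (f i)
  left_inv _ := by ext; simp
  right_inv _ := by ext; simp
  map_add' _ _ := by ext; simp

lemma coeff_genFun (u : Signal m) (i : Fin m) (k : ℕ) : coeff k (genFun u i) = u k i :=
  PowerSeries.coeff_mk k fun k => u k i

lemma genFun_output (G : TransferMatrix m) (u : Signal m) :
    genFun (G.output u) = G.impulseMatrix *ᵥ genFun u := by
  ext i k
  rw [coeff_genFun, output, mulVec, dotProduct, map_sum]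
  refine Finset.sum_congr rfl fun j _ => ?_
  rw [mul_comm, PowerSeries.coeff_mul, Finset.Nat.sum_antidiagonal_eq_sum_range_succ_mk]
  refine Finset.sum_congr rfl fun l _ => ?_
  rw [coeff_genFun, mul_comm]
  rfl

lemma isLoopSolution_iff : IsLoopSolution P Q w₁ w₂ e₁ e₂ ↔
    genFun e₁ = genFun w₁ + Q.impulseMatrix *ᵥ genFun e₂ ∧
      genFun e₂ = genFun w₂ + P.impulseMatrix *ᵥ genFun e₁ := by
  rw [IsLoopSolution, ← genFun_output, ← genFun_output, ← map_add, ← map_add,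
    genFun.injective.eq_iff, genFun.injective.eq_iff]

lemma finiteEnergy_iff : FiniteEnergy u ↔ ∀ i, genFun u i ∈ squareSummableSeries := by
  simp only [mem_squareSummableSeries, coeff_genFun]
  exact ⟨fun h i => h.of_nonneg_of_le (fun _ => sq_nonneg _) fun k =>
    Finset.single_le_sum (f := fun i => u k i ^ 2) (fun _ _ => sq_nonneg _) (Finset.mem_univ i),
    fun h => summable_sum fun i _ => h i⟩

lemma map_coe_commonNum (G : TransferMatrix m) :
    G.commonNum.map (Polynomial.coeToPowerSeries.ringHom (R := ℝ)) =
      Polynomial.coeToPowerSeries.ringHom G.commonDen • G.impulseMatrix :=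
  map_commonNum fun i j => by
    have hcancel := PowerSeries.inv_mul_cancel (recipDen (G i j) : PowerSeries ℝ) (by
      rw [Polynomial.constantCoeff_coe, coeff_zero_recipDen]
      exact one_ne_zero)
    rw [impulseMatrix, map_apply, Polynomial.coeToPowerSeries.ringHom_apply,
      Polynomial.coeToPowerSeries.ringHom_apply, mul_assoc, hcancel, mul_one]

lemma isUnit_one_sub_impulseMatrix_mul (h : (loopMatrix P Q).det.coeff 0 ≠ 0) :
    IsUnit (1 - P.impulseMatrix * Q.impulseMatrix) := by
  have hdet := congrArg det (map_loopMatrix (map_coe_commonNum P) (map_coe_commonNum Q))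
  rw [det_smul, ← RingHom.mapMatrix_apply, ← RingHom.map_det] at hdet
  have hunit : IsUnit (Polynomial.coeToPowerSeries.ringHom (loopMatrix P Q).det) := by
    rw [PowerSeries.isUnit_iff_constantCoeff, Polynomial.coeToPowerSeries.ringHom_apply,
      Polynomial.constantCoeff_coe]
    exact h.isUnit
  rw [hdet] at hunit
  exact (isUnit_iff_isUnit_det _).2 (isUnit_of_mul_isUnit_right hunit)

lemma existsUnique_isLoopSolution (h : (loopMatrix P Q).det.coeff 0 ≠ 0) (w₁ w₂ : Signal m) :
    ∃! e : Signal m × Signal m, IsLoopSolution P Q w₁ w₂ e.1 e.2 := by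
  simp only [isLoopSolution_iff]
  exact ((genFun.toEquiv.prodCongr genFun.toEquiv).existsUnique_congr fun _ => Iff.rfl).2
    (existsUnique_feedback (isUnit_one_sub_impulseMatrix_mul h) (genFun w₁) (genFun w₂))

end GeneratingFunctions

section Stability

lemma internallyStable_of_absSummable (h₀ : (loopMatrix P Q).det.coeff 0 ≠ 0)
    (hQ : ∀ i j, Q.impulseMatrix i j ∈ absSummableSeries ℝ)
    (h : ∀ i j, (closedLoopNum P Q i j : PowerSeries ℝ) *
      ((loopMatrix P Q).det : PowerSeries ℝ)⁻¹ ∈ absSummableSeries ℝ) :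
    InternallyStable P Q := by
  refine ⟨existsUnique_isLoopSolution h₀, fun w₁ w₂ e₁ e₂ hw₁ hw₂ hsol => ?_⟩
  have hfeedback := feedback_iff.1 (isLoopSolution_iff.1 hsol)
  have hclosed := det_smul_eq_closedLoopNum_mulVec (map_coe_commonNum P) (map_coe_commonNum Q)
    hfeedback.2
  rw [Polynomial.coeToPowerSeries.ringHom_apply] at hclosed
  have hcancel := PowerSeries.inv_mul_cancel ((loopMatrix P Q).det : PowerSeries ℝ)
    (by rwa [Polynomial.constantCoeff_coe])
  have hgen : genFun e₂ = (((loopMatrix P Q).det : PowerSeries ℝ)⁻¹ •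
      (closedLoopNum P Q).map Polynomial.coeToPowerSeries.ringHom) *ᵥ
        Sum.elim (genFun w₁) (genFun w₂) := by
    rw [smul_mulVec, ← hclosed, smul_smul, hcancel, one_smul]
  rw [finiteEnergy_iff] at hw₁ hw₂
  have he₂ : ∀ i, genFun e₂ i ∈ squareSummableSeries := by
    rw [hgen]
    refine mulVec_mem_squareSummableSeries (fun i j => ?_) (Sum.forall.2 ⟨hw₁, hw₂⟩)
    rw [Matrix.smul_apply, smul_eq_mul, mul_comm]
    exact h i j
  have hy₂ : ∀ i, (Q.impulseMatrix *ᵥ genFun e₂) i ∈ squareSummableSeries :=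
    mulVec_mem_squareSummableSeries hQ he₂
  have he₁ : ∀ i, genFun e₁ i ∈ squareSummableSeries := fun i => by
    rw [hfeedback.1]
    exact add_mem (hw₁ i) (hy₂ i)
  have hy₁ : ∀ i, (P.impulseMatrix *ᵥ genFun e₁) i ∈ squareSummableSeries := fun i => by
    rw [← sub_eq_of_eq_add' (isLoopSolution_iff.1 hsol).2]
    exact sub_mem (he₂ i) (hw₂ i)
  simp only [finiteEnergy_iff, genFun_output]
  exact ⟨he₁, he₂, hy₁, hy₂⟩

lemma InternallyStable.eval_det_loopMatrix_ne_zero (h : InternallyStable P Q) {x : ℝ}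
    (hx : |x| ≤ 1) (hden : (P.commonDen * Q.commonDen).eval x ≠ 0) :
    (loopMatrix P Q).det.eval x ≠ 0 := by
  intro hdet
  obtain ⟨y, hy₀, hy⟩ := exists_ne_zero_dotProduct_eval_eq_zero hx hdet
  obtain ⟨j, hj⟩ := Function.ne_iff.1 hy₀
  obtain ⟨w₂, hw₂⟩ := (genFun (m := m)).surjective (Pi.single j 1)
  have hw₂_energy : FiniteEnergy w₂ := by
    rw [finiteEnergy_iff, hw₂]
    intro i
    rcases eq_or_ne i j with rfl | hij
    · rw [Pi.single_eq_same, mem_squareSummableSeries]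
      exact summable_of_ne_finset_zero (s := {0}) fun k hk => by
        rw [PowerSeries.coeff_one, if_neg (by simpa using hk), sq, zero_mul]
    · rw [Pi.single_eq_of_ne hij]
      exact zero_mem _
  obtain ⟨⟨e₁, e₂⟩, hsol, -⟩ := h.1 0 w₂
  have he₂ := (h.2 0 w₂ e₁ e₂ (by simp [FiniteEnergy]) hw₂_energy hsol).2.1
  have hfeedback := (feedback_iff.1 (isLoopSolution_iff.1 hsol)).2
  rw [map_zero, hw₂, fromCols_mulVec_sumElim, mulVec_zero, zero_add, one_mulVec] at hfeedback
  have hzero := hy (genFun e₂) (Pi.single j (P.commonDen * Q.commonDen))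
      (finiteEnergy_iff.1 he₂) <| by
    rw [map_loopMatrix (map_coe_commonNum P) (map_coe_commonNum Q), smul_mulVec, hfeedback]
    ext1 i
    rcases eq_or_ne i j with rfl | hij
    · simp
    · simp [Pi.single_eq_of_ne hij]
  rw [Finset.sum_eq_single_of_mem j (Finset.mem_univ j) fun i _ hij => by
    rw [Pi.single_eq_of_ne hij, Polynomial.eval_zero, mul_zero], Pi.single_eq_same] at hzero
  exact mul_ne_zero hj hden hzero

end Stability

section Criterion

lemma exists_eventually_norm_le_of_feedback (hP : P.IsDNI) (hPprop : P.IsProper) (hQ : Q.IsDWSNI)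
    (hQprop : Q.IsProper) (hQsymm : Q.IsSymm) (hx : ‖x‖ ≤ 1) (him : x.im < 0) :
    ∃ K, ∀ᶠ y in 𝓝[Metric.ball 0 1] x, ∀ (e : Fin m → ℂ) (w : Fin m ⊕ Fin m → ℂ),
      (1 - P.recipAt y * Q.recipAt y) *ᵥ e = fromCols (P.recipAt y) 1 *ᵥ w →
      ‖WithLp.toLp 2 e‖ ≤ K * ‖WithLp.toLp 2 w‖ := by
  have hcont : Tendsto Q.recipAt (𝓝[Metric.ball 0 1] x) (𝓝 (Q.recipAt x)) :=
    (differentiableAt_recipAt (hQ.regularAt hx)).continuousAt.mono_left nhdsWithin_le_nhds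
  obtain ⟨c, hc, hform⟩ := exists_pos_eventually_im_quadForm_le <| posDef_negImagPart_iff.2
    fun v hv => hQ.im_quadForm_recipAt_neg hQprop hQsymm hv hx him
  obtain ⟨β, hβ, hnorm⟩ := exists_nonneg_eventually_norm_mulVec_le (Q.recipAt x)
  refine ⟨1 + (β + 2) / c, ?_⟩
  filter_upwards [hcont.eventually hform, hcont.eventually hnorm, self_mem_nhdsWithin,
    nhdsWithin_le_nhds ((isOpen_lt Complex.continuous_im continuous_const).mem_nhds him)]
    with y hform hnorm hy him e w he
  set e₁ := w ∘ Sum.inl + Q.recipAt y *ᵥ e with he₁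
  rw [← Sum.elim_comp_inl_inr w] at he
  have he₂ := (feedback_iff.2 ⟨he₁, he⟩).2
  refine norm_le_of_feedback (e₁ := WithLp.toLp 2 e₁) (y₁ := WithLp.toLp 2 (P.recipAt y *ᵥ e₁))
    hc hβ (WithLp.toLp_add 2 _ _) (by rw [← WithLp.toLp_add, ← he₂]) ?_ ?_ (hnorm e)
    (norm_toLp_comp_le Sum.inl_injective w) (norm_toLp_comp_le Sum.inr_injective w)
  · rw [inner_toLp_mulVec]
    exact hP.im_quadForm_recipAt_nonpos hPprop (mem_ball_zero_iff.1 hy) him e₁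
  · rw [inner_toLp_mulVec]
    exact hform e

lemma isBigO_aeval_closedLoopNum (hP : P.IsDNI) (hPprop : P.IsProper) (hQ : Q.IsDWSNI)
    (hQprop : Q.IsProper) (hQsymm : Q.IsSymm) (hx : ‖x‖ ≤ 1) (him : x.im < 0) (i : Fin m)
    (j : Fin m ⊕ Fin m) : (fun y => (closedLoopNum P Q i j).aeval y) =O[𝓝[Metric.ball 0 1] x]
      fun y => (loopMatrix P Q).det.aeval y := by
  obtain ⟨K, hK⟩ := exists_eventually_norm_le_of_feedback hP hPprop hQ hQprop hQsymm hx him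
  refine .of_bound (K * ‖WithLp.toLp 2 (Pi.single j 1 : Fin m ⊕ Fin m → ℂ)‖) ?_
  filter_upwards [hK, self_mem_nhdsWithin] with y hK hy
  have hPy := hP.regularAt (mem_ball_zero_iff.1 hy)
  have hQy := hQ.regularAt (mem_ball_zero_iff.1 hy).le
  have hden : (P.commonDen * Q.commonDen).aeval y ≠ 0 := by
    rw [map_mul]
    exact mul_ne_zero (aeval_commonDen_ne_zero hPy) (aeval_commonDen_ne_zero hQy)
  have hentry := hK _ _ (one_sub_mul_mulVec_closedLoopNum (map_aeval_commonNum hPy)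
    (map_aeval_commonNum hQy) (IsRegular.of_ne_zero hden) (Pi.single j 1))
  rw [WithLp.toLp_smul, norm_smul, mulVec_single_one, mul_left_comm, mul_comm] at hentry
  exact (PiLp.norm_apply_le _ i).trans hentry

theorem internallyStable_iff_forall_det_one_sub_ne_zero (hP : P.IsDNI) (hPprop : P.IsProper)
    (hone : ¬ P.IsPole 1) (hnegOne : ¬ P.IsPole (-1)) (hQ : Q.IsDWSNI) (hQprop : Q.IsProper)
    (hQsymm : Q.IsSymm) :
    InternallyStable P Q ↔
      ∀ t ∈ Icc (-1 : ℝ) 1, (1 - P.recipAt t * Q.recipAt t).det ≠ 0 := by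
  have hPreg := fun t ht => hP.regularAt_ofReal hone hnegOne (t := t) ht
  have hQreg : ∀ t ∈ Icc (-1 : ℝ) 1, Q.RegularAt t := fun t ht =>
    hQ.regularAt (by simpa using abs_le.2 ht)
  have hdet : ∀ t ∈ Icc (-1 : ℝ) 1, (loopMatrix P Q).det.eval t = 0 ↔
      (1 - P.recipAt t * Q.recipAt t).det = 0 := fun t ht => by
    rw [← aeval_det_loopMatrix_eq_zero_iff (hPreg t ht) (hQreg t ht), ← Complex.coe_algebraMap,
      Polynomial.aeval_algebraMap_apply_eq_algebraMap_eval, map_eq_zero]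
  refine ⟨fun h t ht => ?_, fun h => ?_⟩
  · refine (hdet t ht).not.1 (h.eval_det_loopMatrix_ne_zero (abs_le.2 ht) fun hden => ?_)
    refine mul_ne_zero (aeval_commonDen_ne_zero (hPreg t ht))
      (aeval_commonDen_ne_zero (hQreg t ht)) ?_
    rw [← map_mul, ← Complex.coe_algebraMap,
      Polynomial.aeval_algebraMap_apply_eq_algebraMap_eval, hden, map_zero]
  · have h₀ : (loopMatrix P Q).det.coeff 0 ≠ 0 := by
      rw [Polynomial.coeff_zero_eq_eval_zero]
      exact (hdet 0 (by simp)).not.2 (h 0 (by simp))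
    refine internallyStable_of_absSummable h₀
      (fun i j => mul_inv_mem_absSummableSeries _ fun x hx => hQ.regularAt hx i j) fun i j =>
      mul_inv_mem_absSummableSeries_of_isBigO h₀ fun x hx him hroot => ?_
    rcases him.lt_or_eq with him | him
    · exact isBigO_aeval_closedLoopNum hP hPprop hQ hQprop hQsymm hx him i j
    · obtain ⟨t, rfl⟩ : ∃ t : ℝ, (t : ℂ) = x := ⟨x.re, Complex.ext rfl him.symm⟩
      have ht : t ∈ Icc (-1 : ℝ) 1 := abs_le.1 (by simpa using hx)
      exact absurd ((aeval_det_loopMatrix_eq_zero_iff (hPreg t ht) (hQreg t ht)).1 hroot) (h t ht)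

end Criterion

end TransferMatrix

end

theorem mainTheorem4 (m : ℕ) (hm : 0 < m) (P Q : TransferMatrix m)
    (hPproper : P.IsProper) (hP : P.IsDNI)
    (hPpos : ¬ P.IsPole 1) (hPneg : ¬ P.IsPole (-1))
    (hQproper : Q.IsProper) (hQsymm : Q.IsSymm) (hQ : Q.IsDWSNI)
    (hPQ : P.valueAt (-1) * Q.valueAt (-1) = 0)
    (hQneg : (Q.valueAt (-1)).PosSemidef) :
    HasOnlyRealEigenvalues (P.valueAt 1 * Q.valueAt 1) ∧
      (TransferMatrix.InternallyStable P Q ↔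
        largestEigenvalue (P.valueAt 1 * Q.valueAt 1) < 1) := by
  have hPherm : (P.valueAt 1).IsHermitian := by
    simpa [P.recipAt_one hPproper] using
      hP.isHermitian_recipAt_ofReal hPproper hPpos hPneg (right_mem_Icc.2 (by norm_num))
  have hQpos : (Q.valueAt 1).PosDef := by
    simpa [Q.recipAt_one hQproper] using
      hQ.posDef_recipAt_ofReal hQproper hQsymm hQneg (right_mem_Ioc.2 (by norm_num))
  have hreal := hasOnlyRealEigenvalues_mul hPherm hQpos.posSemidef
  refine ⟨hreal, ?_⟩
  rw [TransferMatrix.internallyStable_iff_forall_det_one_sub_ne_zero hP hPproper hPpos hPneg hQ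
      hQproper hQsymm,
    forall_det_one_sub_ne_zero_iff_spectrum_lt_one hP hPproper hPpos hPneg hQ hQproper hQsymm hPQ
      hQneg,
    hreal.largestEigenvalue_lt_iff hm]
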